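/- For a finite simple graph $G$ and $\alpha\in[0,1]$ let $A_\alpha(G)=\alpha D(G)+(1-\alpha)A(G)$, where $D(G)$ is the diagonal matrix of vertex degrees and $A(G)$ is the adjacency matrix; the $\alpha$-spectral radius $\rho_\alpha(G)$ is the spectral radius of $A_\alpha(G)$. A connected graph is unicyclic if it has as many edges as vertices. For integers $s,a,b\ge 0$ let $\Delta_2(s;a,b)$ be the graph obtained from a triangle with vertices $w_1,w_2,w_3$ by attaching $s$ pendant edges and a pendant path of length $a$ at $w_2$, and a pendant path of length $b$ at $w_3$. **Theorem.** Let $\alpha\in[0,1)$ and let $n,d$ be integers with $2\le d\le n-2$. Let $U_2^*(n,d)=\Delta_2(s;a,b)$, where $s,a,b\ge 0$ are the integers determined by $0\le a-b\le 1$, $d=a+b+1$ and $n=s+a+b+3$. Then $U_2^*(n,d)$ is a connected unicyclic graph with $n$ vertices and diameter $d$, and every connected unicyclic graph $G$ with $n$ vertices and diameter $d$ satisfies $\rho_\alpha(G)\le\rho_\alpha(U_2^*(n,d))$, with equality if and only if $G\cong U_2^*(n,d)$. -/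

import Mathlib

/-- The matrix `A_α(G) = α D(G) + (1 - α) A(G)`, where `D(G)` is the diagonal matrix of vertex
degrees and `A(G)` is the adjacency matrix. -/
noncomputable def alphaMatrix {V : Type*} [Fintype V] [DecidableEq V] (α : ℝ)
    (G : SimpleGraph V) [DecidableRel G.Adj] : Matrix V V ℝ :=
  α • G.degMatrix ℝ + (1 - α) • G.adjMatrix ℝ

open Classical in
/-- The `α`-spectral radius of a finite graph: the spectral radius of `A_α(G)`, that is, the largest
absolute value of an eigenvalue. The matrix is real symmetric, so all its complex eigenvalues are
real and the spectrum over `ℝ` is the whole spectrum. -/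
noncomputable def alphaSpectralRadius {V : Type*} [Fintype V] [DecidableEq V] (α : ℝ)
    (G : SimpleGraph V) : ENNReal :=
  spectralRadius ℝ (alphaMatrix α G)

/-- The class of connected unicyclic graphs (as many edges as vertices) with `n` vertices and
diameter `d`. -/
def IsUnicyclicOfDiam {V : Type*} [Fintype V] (n d : ℕ) (G : SimpleGraph V) : Prop :=
  G.Connected ∧ Fintype.card V = n ∧ G.edgeSet.ncard = n ∧ G.diam = d

/-- Vertices of `delta2 s a b`: the triangle vertices `w₁, w₂, w₃` (numbered `0, 1, 2`), then `s`
leaves, then `a` path vertices, then `b` path vertices. -/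
abbrev Delta2Vertex (s a b : ℕ) : Type := Fin 3 ⊕ Fin s ⊕ Fin a ⊕ Fin b

/-- The edges of `delta2 s a b`, each listed in at least one direction (pairs of equal vertices
are ignored). -/
def delta2Rel (s a b : ℕ) : Delta2Vertex s a b → Delta2Vertex s a b → Prop
  | .inl _, .inl _ => True
  | .inl w, .inr (.inl _) => w = 1
  | .inl w, .inr (.inr (.inl i)) => w = 1 ∧ i.val = 0
  | .inl w, .inr (.inr (.inr i)) => w = 2 ∧ i.val = 0
  | .inr (.inr (.inl i)), .inr (.inr (.inl j)) => j.val = i.val + 1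
  | .inr (.inr (.inr i)), .inr (.inr (.inr j)) => j.val = i.val + 1
  | _, _ => False

/-- The graph obtained from a triangle `w₁ w₂ w₃` by attaching `s` pendant edges and a pendant path
of length `a` at `w₂`, and a pendant path of length `b` at `w₃`. -/
def delta2 (s a b : ℕ) : SimpleGraph (Delta2Vertex s a b) :=
  SimpleGraph.fromRel (delta2Rel s a b)

/-!
The quadratic form of `A_α(G)` at a vector `x` is the sum over the edges `uv` of the weights
`α (x_u² + x_v²) + 2 (1 - α) x_u x_v`, which are increasing in both values when `x` is nonnegative
(`dotProduct_alphaMatrix_mulVec`). The proof takes the Perron vector `x` of an arbitrary competitor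
`G` and rearranges its values on the extremal graph in one step.

The extremal graph is seen as a *spiral* (`IsSpiral`): a diametral path of length `d` is listed from
the middle outwards as `t 0, t 1, …, t d`, so that its edges are `t 0 t 1` and `t i t (i + 2)`; all
other vertices are joined to `t 0`, and one of them, `w`, also to `t 1`. Let `P` be a diametral path
of `G`, and list its vertices as `t 0, t 1, …` by decreasing values of `x`. By a discrete
rearrangement inequality (`adjSum_le_spiralSum`, `sum_edgeWeight_path_le`) the edges of `P` weigh at
most as much as those of the spiral on `t`. The remaining edges of `G` are one for each vertex off
`P`, leading to a parent, and one extra edge. The weight of an edge to a parent does not decrease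
when the parent is replaced by the vertex of maximal value, and after an exchange of at most two
vertices between the path and the rest the extra edge, too, weighs at most as much as the edge from
`w` to `t 1` (`exists_le_spiralWeight`). By the variational characterization of the spectral radius
(`exists_perron`) this proves the inequality.

If equality holds then `x` is a Perron vector of `G` and of the spiral, and the eigenvalue
equations of the two graphs can be compared. In the spiral `x w < x (t 1)` as soon as the diameter
is at least three (`IsSpiral.apply_w_lt`), which excludes most positions of the extra edge. The
equations at `t 0` show that in `G`, too, this vertex is adjacent to all vertices off `P`
(`hub_of_eigenvector`), and along the arms of the path the equations determine the values one after
the other, so that the arms have equal lengths in both graphs and `G` is a spiral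
(`exists_isSpiral_of_hub`). For diameter two the equation at `t 0` alone suffices
(`exists_isSpiral_of_star`).
-/

/-! ### The quadratic form of `A_α` and the Perron vector -/

section Spectral

open Finset Matrix

/-- The contribution of an edge whose ends carry the values `a` and `b` to the quadratic form of
`A_α`. -/
def edgeWeight (α a b : ℝ) : ℝ := α * (a ^ 2 + b ^ 2) + 2 * (1 - α) * (a * b)

theorem edgeWeight_comm (α a b : ℝ) : edgeWeight α a b = edgeWeight α b a := by
  unfold edgeWeight; ring

theorem edgeWeight_mono {α : ℝ} (h0 : 0 ≤ α) (h1 : α < 1) {a a' b b' : ℝ} (ha : 0 ≤ a)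
    (hb : 0 ≤ b) (haa : a ≤ a') (hbb : b ≤ b') : edgeWeight α a b ≤ edgeWeight α a' b' := by
  have h2 : 0 ≤ 2 * (1 - α) := by linarith
  have h3 : a * b ≤ a' * b' := mul_le_mul haa hbb hb (ha.trans haa)
  have h4 : a ^ 2 + b ^ 2 ≤ a' ^ 2 + b' ^ 2 := by gcongr
  exact add_le_add (mul_le_mul_of_nonneg_left h4 h0) (mul_le_mul_of_nonneg_left h3 h2)

theorem edgeWeight_strictMono_left {α : ℝ} (h0 : 0 ≤ α) (h1 : α < 1) {a a' b : ℝ} (ha : 0 ≤ a)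
    (hb : 0 < b) (haa : a < a') : edgeWeight α a b < edgeWeight α a' b := by
  have h2 : 0 < 2 * (1 - α) := by linarith
  have h3 : a * b < a' * b := by gcongr
  have h4 : a ^ 2 + b ^ 2 ≤ a' ^ 2 + b ^ 2 := by gcongr
  exact add_lt_add_of_le_of_lt (mul_le_mul_of_nonneg_left h4 h0) (mul_lt_mul_of_pos_left h3 h2)

/-- The weight `edgeWeight` of the edges of the complete graph, for the vertex values `x`. -/
def pairWeight {V : Type*} (α : ℝ) (x : V → ℝ) : Sym2 V → ℝ :=
  Sym2.lift ⟨fun u v => edgeWeight α (x u) (x v), fun _ _ => edgeWeight_comm _ _ _⟩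

@[simp] theorem pairWeight_mk {V : Type*} (α : ℝ) (x : V → ℝ) (u v : V) :
    pairWeight α x s(u, v) = edgeWeight α (x u) (x v) := rfl

variable {V : Type*} [Fintype V] [DecidableEq V]

open Classical in
theorem alphaMatrix_mulVec_apply (α : ℝ) (G : SimpleGraph V) (x : V → ℝ) (v : V) :
    (alphaMatrix α G *ᵥ x) v = ∑ u with G.Adj v u, (α * x v + (1 - α) * x u) := by
  rw [alphaMatrix, Matrix.add_mulVec, Matrix.smul_mulVec, Matrix.smul_mulVec, Pi.add_apply,
    Pi.smul_apply, Pi.smul_apply, SimpleGraph.adjMatrix_mulVec_apply, SimpleGraph.degMatrix,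
    Matrix.mulVec_diagonal, Finset.sum_add_distrib, Finset.sum_const, ← Finset.mul_sum,
    ← SimpleGraph.card_neighborFinset_eq_degree]
  have : (univ.filter fun u => G.Adj v u) = G.neighborFinset v := by ext; simp
  rw [this]
  simp only [smul_eq_mul, nsmul_eq_mul]
  ring

open Classical in
theorem alphaMatrix_isHermitian (α : ℝ) (G : SimpleGraph V) : (alphaMatrix α G).IsHermitian := by
  rw [Matrix.IsHermitian, Matrix.conjTranspose_eq_transpose_of_trivial, alphaMatrix,
    Matrix.transpose_add, Matrix.transpose_smul, Matrix.transpose_smul,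
    SimpleGraph.transpose_adjMatrix, SimpleGraph.degMatrix, Matrix.diagonal_transpose]

open Classical in
theorem sum_adj_eq_two_mul_sum_edgeFinset (G : SimpleGraph V) (F : Sym2 V → ℝ) :
    ∑ p : V × V with G.Adj p.1 p.2, F s(p.1, p.2) = 2 * ∑ e ∈ G.edgeFinset, F e := by
  rw [← Finset.sum_fiberwise_of_maps_to (g := fun p : V × V => s(p.1, p.2)) (t := G.edgeFinset)
    (by simp), Finset.mul_sum]
  refine Finset.sum_congr rfl fun e he => ?_
  induction e with | _ a b =>
  have hab : G.Adj a b := by simpa using he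
  have : (univ.filter (fun p : V × V => G.Adj p.1 p.2)).filter
      (fun p : V × V => s(p.1, p.2) = s(a, b)) = {(a, b), (b, a)} := by
    ext ⟨u, v⟩
    simp only [mem_filter, mem_univ, true_and, Sym2.eq_iff, mem_insert, mem_singleton,
      Prod.mk.injEq]
    constructor
    · exact fun h => h.2
    · rintro (⟨rfl, rfl⟩ | ⟨rfl, rfl⟩)
      · exact ⟨hab, Or.inl ⟨rfl, rfl⟩⟩
      · exact ⟨hab.symm, Or.inr ⟨rfl, rfl⟩⟩
  rw [this, Finset.sum_pair (by simp [hab.ne]), Sym2.eq_swap (a := b)]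
  ring

open Classical in
/-- The quadratic form of `A_α(G)` is a sum over the edges of `G`. -/
theorem dotProduct_alphaMatrix_mulVec (α : ℝ) (G : SimpleGraph V) (x : V → ℝ) :
    x ⬝ᵥ (alphaMatrix α G *ᵥ x) = ∑ e ∈ G.edgeFinset, pairWeight α x e := by
  have h1 : x ⬝ᵥ (alphaMatrix α G *ᵥ x) =
      ∑ p : V × V with G.Adj p.1 p.2, x p.1 * (α * x p.1 + (1 - α) * x p.2) := by
    simp only [dotProduct, alphaMatrix_mulVec_apply, Finset.sum_filter, Fintype.sum_prod_type,
      Finset.mul_sum]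
    refine Finset.sum_congr rfl fun v _ => Finset.sum_congr rfl fun u _ => ?_
    split_ifs <;> simp
  have h2 : ∑ p : V × V with G.Adj p.1 p.2, x p.1 * (α * x p.1 + (1 - α) * x p.2) =
      ∑ p : V × V with G.Adj p.1 p.2, x p.2 * (α * x p.2 + (1 - α) * x p.1) := by
    simp only [Finset.sum_filter]
    rw [← Equiv.sum_comp (Equiv.prodComm V V)]
    simp [SimpleGraph.adj_comm]
  have h3 := sum_adj_eq_two_mul_sum_edgeFinset G (pairWeight α x)
  have h4 : ∑ p : V × V with G.Adj p.1 p.2, pairWeight α x s(p.1, p.2) =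
      ∑ p : V × V with G.Adj p.1 p.2, x p.1 * (α * x p.1 + (1 - α) * x p.2) +
      ∑ p : V × V with G.Adj p.1 p.2, x p.2 * (α * x p.2 + (1 - α) * x p.1) := by
    rw [← Finset.sum_add_distrib]
    refine Finset.sum_congr rfl fun p _ => ?_
    rw [pairWeight_mk, edgeWeight]; ring
  linarith

open Classical in
/-- The Perron vector of a connected graph, together with the variational characterization of the
`α`-spectral radius. -/
theorem exists_perron {α : ℝ} (h0 : 0 ≤ α) (h1 : α < 1) {G : SimpleGraph V} (hG : G.Connected) :
    ∃ (ρ : ℝ) (x : V → ℝ), alphaSpectralRadius α G = ENNReal.ofReal ρ ∧ 0 ≤ ρ ∧ (∀ v, 0 < x v) ∧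
      alphaMatrix α G *ᵥ x = ρ • x ∧
      (∀ y : V → ℝ, y ⬝ᵥ (alphaMatrix α G *ᵥ y) ≤ ρ * (y ⬝ᵥ y)) ∧
      (∀ y : V → ℝ, y ⬝ᵥ (alphaMatrix α G *ᵥ y) = ρ * (y ⬝ᵥ y) →
        alphaMatrix α G *ᵥ y = ρ • y) := by
  have := hG.nonempty
  set A := alphaMatrix α G with hA
  have hH : A.IsHermitian := alphaMatrix_isHermitian α G
  obtain ⟨i, hi⟩ := Finite.exists_max hH.eigenvalues
  set ρ := hH.eigenvalues i with hρ
  -- the variational principle amounts to `ρ I - A` being positive semidefinite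
  have hB : (ρ • (1 : Matrix V V ℝ) - A).PosSemidef := by
    have hBH : (ρ • (1 : Matrix V V ℝ) - A).IsHermitian := by
      refine Matrix.IsHermitian.sub ?_ hH
      simp [Matrix.IsHermitian]
    rw [hBH.posSemidef_iff_eigenvalues_nonneg]
    intro j
    have hj := hBH.eigenvalues_mem_spectrum_real j
    simp only [Pi.zero_apply]
    generalize hBH.eigenvalues j = β at hj ⊢
    rw [← Algebra.algebraMap_eq_smul_one, ← spectrum.singleton_sub_eq,
      hH.spectrum_real_eq_range_eigenvalues] at hj
    obtain ⟨a, ha, b, ⟨k, rfl⟩, hab⟩ := hj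
    rw [Set.mem_singleton_iff] at ha
    have := hi k
    rw [← hab, ha]
    simpa using this
  have hquad (y : V → ℝ) : y ⬝ᵥ ((ρ • (1 : Matrix V V ℝ) - A) *ᵥ y) =
      ρ * (y ⬝ᵥ y) - y ⬝ᵥ (A *ᵥ y) := by
    rw [Matrix.sub_mulVec, dotProduct_sub, Matrix.smul_mulVec, Matrix.one_mulVec, dotProduct_smul,
      smul_eq_mul]
  have hle (y : V → ℝ) : y ⬝ᵥ (A *ᵥ y) ≤ ρ * (y ⬝ᵥ y) := by
    have := hB.dotProduct_mulVec_nonneg y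
    rw [star_trivial, hquad] at this
    linarith
  have heq (y : V → ℝ) (hy : y ⬝ᵥ (A *ᵥ y) = ρ * (y ⬝ᵥ y)) : A *ᵥ y = ρ • y := by
    have := (hB.dotProduct_mulVec_zero_iff y).1 (by rw [star_trivial, hquad]; linarith)
    rw [Matrix.sub_mulVec, Matrix.smul_mulVec, Matrix.one_mulVec, sub_eq_zero] at this
    exact this.symm
  have habs (y : V → ℝ) : |y ⬝ᵥ (A *ᵥ y)| ≤ (fun v => |y v|) ⬝ᵥ (A *ᵥ fun v => |y v|) := by
    rw [hA, dotProduct_alphaMatrix_mulVec, dotProduct_alphaMatrix_mulVec]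
    refine (Finset.abs_sum_le_sum_abs _ _).trans (Finset.sum_le_sum fun e _ => ?_)
    induction e with | _ a b =>
    simp only [pairWeight_mk, edgeWeight, sq_abs, ← abs_mul]
    refine (abs_add_le _ _).trans (le_of_eq ?_)
    rw [abs_of_nonneg (by positivity), abs_mul (2 * (1 - α)),
      abs_of_nonneg (by linarith : 0 ≤ 2 * (1 - α))]
  have hsq (y : V → ℝ) : (fun v => |y v|) ⬝ᵥ (fun v => |y v|) = y ⬝ᵥ y := by
    simp [dotProduct, abs_mul_abs_self]
  -- the absolute values of an eigenvector for `ρ` also attain the maximum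
  set z : V → ℝ := fun v => hH.eigenvectorBasis i v with hz
  have hzA : A *ᵥ z = ρ • z := hH.mulVec_eigenvectorBasis i
  have hz0 : z ≠ 0 := by
    intro h
    have : hH.eigenvectorBasis i = 0 := by ext v; exact congrFun h v
    exact hH.eigenvectorBasis.toBasis.ne_zero i (by simpa using this)
  set x : V → ℝ := fun v => |z v| with hx
  have hxA : A *ᵥ x = ρ • x := by
    refine heq x (le_antisymm (hle x) ?_)
    have h2 := habs z
    rw [hzA, dotProduct_smul, smul_eq_mul] at h2
    rw [hx, hsq]
    exact (le_abs_self _).trans h2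
  have hxnn (v : V) : 0 ≤ x v := abs_nonneg _
  -- a zero of a nonnegative eigenvector spreads to the neighbours
  have hstep (u v : V) (huv : G.Adj u v) (hu : x u = 0) : x v = 0 := by
    have h := congrFun hxA u
    rw [hA, alphaMatrix_mulVec_apply, Pi.smul_apply, hu, smul_zero,
      Finset.sum_eq_zero_iff_of_nonneg fun w _ => by
        have := hxnn w
        have : 0 ≤ (1 - α) * x w := mul_nonneg (by linarith) this
        linarith] at h
    have := h v (by simpa using huv)
    rw [mul_zero, zero_add, mul_eq_zero] at this
    exact this.resolve_left (by linarith)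
  have hxpos (v : V) : 0 < x v := by
    refine (hxnn v).lt_of_ne' fun hv => hz0 (funext fun w => ?_)
    obtain ⟨p⟩ := hG v w
    have : x w = 0 := by
      clear_value x
      clear hx
      induction p with
      | nil => exact hv
      | cons hadj _ ih => exact ih (hstep _ _ hadj hv)
    simpa [hx] using this
  have hxx : 0 < x ⬝ᵥ x := Finset.sum_pos (fun v _ => mul_pos (hxpos v) (hxpos v)) univ_nonempty
  have hρ0 : 0 ≤ ρ := by
    have h2 := habs x
    have h3 : (fun v => |x v|) = x := funext fun v => abs_of_nonneg (hxnn v)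
    rw [h3, hxA, dotProduct_smul, smul_eq_mul] at h2
    have := (abs_nonneg _).trans h2
    exact nonneg_of_mul_nonneg_left this hxx
  refine ⟨ρ, x, ?_, hρ0, hxpos, hxA, hle, heq⟩
  have hspec : ρ ∈ spectrum ℝ A := hH.eigenvalues_mem_spectrum_real i
  have hrad : alphaSpectralRadius α G = spectralRadius ℝ A := rfl
  rw [hrad, spectralRadius]
  refine le_antisymm (iSup₂_le fun μ hμ => ?_) ?_
  · rw [hH.spectrum_real_eq_range_eigenvalues] at hμ
    obtain ⟨j, rfl⟩ := hμ
    set y : V → ℝ := fun v => hH.eigenvectorBasis j v with hy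
    have hyA : A *ᵥ y = hH.eigenvalues j • y := hH.mulVec_eigenvectorBasis j
    have hy0 : y ≠ 0 := by
      intro h
      have : hH.eigenvectorBasis j = 0 := by ext v; exact congrFun h v
      exact hH.eigenvectorBasis.toBasis.ne_zero j (by simpa using this)
    have hyy : 0 < y ⬝ᵥ y := by
      refine lt_of_le_of_ne (Finset.sum_nonneg fun v _ => mul_self_nonneg _) fun h => hy0 ?_
      exact dotProduct_self_eq_zero.1 h.symm
    have h2 := (habs y).trans (hle _)
    rw [hsq, hyA, dotProduct_smul, smul_eq_mul, abs_mul, abs_of_pos hyy] at h2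
    have h3 := le_of_mul_le_mul_right h2 hyy
    rw [← Real.norm_eq_abs] at h3
    rw [← ENNReal.ofReal_coe_nnreal, coe_nnnorm]
    exact ENNReal.ofReal_le_ofReal h3
  · refine le_trans (le_of_eq ?_) (le_iSup₂ (f := fun (k : ℝ) (_ : k ∈ spectrum ℝ A) =>
      ((‖k‖₊ : NNReal) : ENNReal)) ρ hspec)
    rw [← ENNReal.ofReal_coe_nnreal, coe_nnnorm, Real.norm_of_nonneg hρ0]

open Classical in
theorem alphaSpectralRadius_congr {W : Type*} [Fintype W] [DecidableEq W] (α : ℝ)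
    {G : SimpleGraph V} {H : SimpleGraph W} (φ : G ≃g H) :
    alphaSpectralRadius α G = alphaSpectralRadius α H := by
  have h : Matrix.reindexAlgEquiv ℝ ℝ φ.toEquiv (alphaMatrix α G) = alphaMatrix α H := by
    ext i j
    have hij : G.Adj (φ.symm i) (φ.symm j) ↔ H.Adj i j := φ.symm.map_adj_iff
    simp only [Matrix.coe_reindexAlgEquiv, Matrix.reindex_apply, Matrix.submatrix_apply,
      alphaMatrix, Matrix.add_apply, Matrix.smul_apply, SimpleGraph.degMatrix,
      SimpleGraph.adjMatrix_apply, Matrix.diagonal_apply]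
    have e (v : W) : φ.toEquiv.symm v = φ.symm v := rfl
    simp only [e, hij, φ.symm.injective.eq_iff]
    congr 2
    refine if_congr Iff.rfl ?_ rfl
    congr 1
    convert φ.symm.degree_eq i
    rfl
  unfold alphaSpectralRadius spectralRadius
  rw [← h, AlgEquiv.spectrum_eq]

end Spectral

/-! ### The rearrangement inequality for paths -/

section Rearrangement

open Finset

/-- The sum of the products of consecutive entries of a list. -/
def adjSum : List ℝ → ℝ
  | a :: b :: l => a * b + adjSum (b :: l)
  | _ => 0

/-- The sum of the products of entries at distance two, plus the product of the last two entries.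
For an increasing list this is the value of `adjSum` at the arrangement with the largest entry in
the middle and the entries decreasing alternately on both sides. -/
def spiralSum : List ℝ → ℝ
  | a :: b :: c :: l => a * c + spiralSum (b :: c :: l)
  | [a, b] => a * b
  | _ => 0

theorem adjSum_remove_zero : ∀ l₁ l₂ : List ℝ, (∀ a ∈ l₁ ++ l₂, 0 ≤ a) →
    adjSum (l₁ ++ 0 :: l₂) ≤ adjSum (l₁ ++ l₂)
  | [], [], _ => by simp [adjSum]
  | [], b :: l, _ => by simp [adjSum]
  | [a], [], _ => by simp [adjSum]
  | [a], b :: l, h => by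
    have ha : 0 ≤ a := h a (by simp)
    have hb : 0 ≤ b := h b (by simp)
    simpa [adjSum] using mul_nonneg ha hb
  | a :: b :: l₁, l₂, h => by
    have := adjSum_remove_zero (b :: l₁) l₂ fun c hc => h c (by
      simp only [List.cons_append, List.mem_cons] at hc ⊢; exact Or.inr hc)
    simpa [adjSum] using this

/-- The effect of a translation on `adjSum`: only the two ends of the list have a single
neighbour. -/
theorem adjSum_map_add (m : ℝ) : ∀ (h : ℝ) (l : List ℝ),
    adjSum ((h :: l).map (· + m)) = adjSum (h :: l) +
      m * (2 * (h :: l).sum - h - (h :: l).getLast (by simp)) + l.length * m ^ 2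
  | h, [] => by simp [adjSum, two_mul]
  | h, b :: l => by
    have ih := adjSum_map_add m b l
    simp only [List.map_cons, adjSum, List.sum_cons, List.getLast_cons_cons, List.length_cons]
      at ih ⊢
    rw [ih]; push_cast; ring

theorem spiralSum_map_add (m : ℝ) : ∀ (a b : ℝ) (l : List ℝ),
    spiralSum ((a :: b :: l).map (· + m)) = spiralSum (a :: b :: l) +
      m * (2 * (a :: b :: l).sum - a - b) + (l.length + 1) * m ^ 2
  | a, b, [] => by simp [spiralSum]; ring
  | a, b, c :: l => by
    have ih := spiralSum_map_add m b c l
    simp only [List.map_cons, spiralSum, List.sum_cons, List.length_cons] at ih ⊢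
    rw [ih]; push_cast; ring

/-- The two ends of an arrangement of an increasing list are at least its two smallest entries. -/
theorem add_le_add_ends {a b h t : ℝ} {l z : List ℝ} (hp : (h :: (l ++ [t])).Perm (a :: b :: z))
    (hz : (a :: b :: z).Pairwise (· ≤ ·)) : a + b ≤ h + t := by
  simp only [List.pairwise_cons] at hz
  obtain ⟨h1, h2, -⟩ := hz
  have hh : h ∈ a :: b :: z := hp.subset (by simp)
  by_cases hha : h = a
  · subst hha
    have ht : t ∈ b :: z := (List.perm_cons h).1 hp |>.subset (by simp)
    have : b ≤ t := by
      rcases List.mem_cons.1 ht with rfl | ht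
      · exact le_rfl
      · exact h2 t ht
    linarith
  · have hb : b ≤ h := by
      rcases List.mem_cons.1 hh with h' | hh
      · exact absurd h' hha
      rcases List.mem_cons.1 hh with h' | hh
      · exact h'.ge
      · exact h2 h hh
    have ht : t ∈ a :: b :: z := hp.subset (by simp)
    have : a ≤ t := by
      rcases List.mem_cons.1 ht with h' | ht
      · exact h'.ge
      · exact h1 t ht
    linarith

/-- Discrete rearrangement inequality on a path: the arrangement with the largest value in the
middle, decreasing alternately on both sides, maximizes the sum of the products of neighbours. The
smallest value is subtracted from all entries, which reduces the ends to the two smallest values;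
the entry that has become zero is then dropped. -/
theorem adjSum_le_spiralSum : ∀ (z l : List ℝ), l.Perm z → z.Pairwise (· ≤ ·) →
    (∀ a ∈ z, 0 ≤ a) → adjSum l ≤ spiralSum z
  | [], l, hp, _, _ => by rw [List.perm_nil.1 hp]; simp [adjSum, spiralSum]
  | [a], l, hp, _, _ => by rw [List.perm_singleton.1 hp]; simp [adjSum, spiralSum]
  | m :: b :: z, l, hp, hz, h0 => by
    have hm : 0 ≤ m := h0 m (by simp)
    have hz' := List.pairwise_cons.1 hz
    -- the same lists after subtracting the minimum
    set l' := l.map (· - m) with hl'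
    set z' := (b :: z).map (· - m) with hz'def
    have hback (k : List ℝ) : k = (k.map (· - m)).map (· + m) := by simp [Function.comp_def]
    have hp' : l'.Perm (0 :: z') := by
      have := hp.map (· - m)
      simpa [hl', hz'def] using this
    have hzz : (m :: b :: z).map (· - m) = 0 :: z' := by simp [hz'def]
    have hz'0 : ∀ a ∈ z', 0 ≤ a := by
      intro a ha
      obtain ⟨c, hc, rfl⟩ := List.mem_map.1 ha
      have := hz'.1 c hc
      linarith
    have hz's : z'.Pairwise (· ≤ ·) := by
      rw [hz'def, List.pairwise_map]
      exact hz'.2.imp fun h => by linarith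
    obtain ⟨l₁, l₂, hl12⟩ := List.append_of_mem (hp'.symm.subset (List.mem_cons_self))
    have hp'' : (l₁ ++ l₂).Perm z' := by
      rw [hl12] at hp'
      exact (List.perm_cons 0).1 (List.perm_middle.symm.trans hp')
    have ih := adjSum_le_spiralSum z' (l₁ ++ l₂) hp'' hz's hz'0
    have h3 : adjSum l' ≤ spiralSum z' := by
      rw [hl12]
      exact (adjSum_remove_zero l₁ l₂ fun a ha => hz'0 a (hp''.subset ha)).trans ih
    have hsp : spiralSum (0 :: z') = spiralSum z' := by
      rw [hz'def]
      cases z <;> simp [spiralSum]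
    have hlen := hp'.length_eq
    have hsum := hp'.sum_eq
    rw [hback l, hback (m :: b :: z), hzz, ← hl']
    clear_value l'
    rcases l' with _ | ⟨h, k⟩
    · simp at hlen
    have hk : k ≠ [] := by
      rintro rfl
      simp [hz'def] at hlen
    obtain ⟨k', t, rfl⟩ : ∃ k' t, k = k' ++ [t] := ⟨k.dropLast, k.getLast hk,
      (List.dropLast_append_getLast hk).symm⟩
    rw [adjSum_map_add]
    have hz'cons : z' = (b - m) :: z.map (· - m) := rfl
    rw [hz'cons] at hp' hsp h3 hsum hlen hz'0 hz's ⊢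
    rw [spiralSum_map_add, hsum, hsp]
    have hends : 0 + (b - m) ≤ h + t := by
      refine add_le_add_ends hp' ?_
      rw [List.pairwise_cons]
      exact ⟨fun a ha => hz'0 a ha, hz's⟩
    have hlast : (h :: (k' ++ [t])).getLast (by simp) = t := by
      rw [List.getLast_cons (by simp)]; simp
    have hlen' : ((k' ++ [t]).length : ℝ) = (z.map (· - m)).length + 1 := by
      simp only [List.length_cons, Nat.add_right_cancel_iff] at hlen
      exact_mod_cast hlen
    rw [hlast, hlen']
    have := mul_le_mul_of_nonneg_left hends hm
    nlinarith
  termination_by z => z.length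
  decreasing_by simp

theorem adjSum_map_range : ∀ (n : ℕ) (v : ℕ → ℝ),
    adjSum ((List.range (n + 1)).map v) = ∑ i ∈ range n, v i * v (i + 1)
  | 0, v => by simp [adjSum]
  | n + 1, v => by
    have ih := adjSum_map_range n (fun i => v (i + 1))
    rw [List.range_succ_eq_map, List.map_cons, List.map_map]
    rw [List.range_succ_eq_map, List.map_cons, List.map_map] at ih ⊢
    rw [adjSum, Finset.sum_range_succ']
    simp only [Function.comp_def, Nat.succ_eq_add_one] at ih ⊢
    rw [ih]; ring_nf

theorem spiralSum_map_range : ∀ (n : ℕ) (v : ℕ → ℝ),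
    spiralSum ((List.range (n + 2)).map v) =
      v n * v (n + 1) + ∑ i ∈ range n, v i * v (i + 2)
  | 0, v => by simp [spiralSum, List.range_succ]
  | n + 1, v => by
    have ih := spiralSum_map_range n (fun i => v (i + 1))
    rw [List.range_succ_eq_map, List.map_cons, List.map_map]
    rw [List.range_succ_eq_map, List.map_cons, List.map_map] at ih ⊢
    rw [List.range_succ_eq_map, List.map_cons, List.map_map] at ih ⊢
    rw [spiralSum, Finset.sum_range_succ']
    simp only [Function.comp_def, Nat.succ_eq_add_one] at ih ⊢
    rw [ih]; ring_nf

/-- Rearrangement inequality for the edge weights: `u` lists the values `v 0, …, v (n + 1)` along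
a path in decreasing order. -/
theorem sum_edgeWeight_path_le {α : ℝ} (h0 : 0 ≤ α) (h1 : α < 1) (n : ℕ) (v u : ℕ → ℝ)
    (hu0 : ∀ i ≤ n + 1, 0 ≤ u i) (hanti : ∀ i j, i ≤ j → j ≤ n + 1 → u j ≤ u i)
    (hp : ((List.range (n + 2)).map v).Perm ((List.range (n + 2)).map u)) :
    ∑ i ∈ range (n + 1), edgeWeight α (v i) (v (i + 1)) ≤
      edgeWeight α (u 0) (u 1) + ∑ i ∈ range n, edgeWeight α (u i) (u (i + 2)) := by
  -- the increasing enumeration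
  set w : ℕ → ℝ := fun i => u (n + 1 - i) with hw
  have hrev : (List.range (n + 2)).map w = ((List.range (n + 2)).map u).reverse := by
    rw [← List.map_reverse]
    refine List.ext_getElem (by simp) fun i hi hi' => ?_
    simp at hi
    simp only [List.getElem_map, List.getElem_range, List.getElem_reverse, hw, List.length_range]
    congr 1
  have hpw : ((List.range (n + 2)).map v).Perm ((List.range (n + 2)).map w) := by
    rw [hrev]; exact hp.trans (List.reverse_perm _).symm
  have hpair : ((List.range (n + 2)).map w).Pairwise (· ≤ ·) := by
    rw [List.pairwise_map]
    exact List.pairwise_lt_range.imp fun {a b} hab => hanti _ _ (by omega) (by omega)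
  have hprod := adjSum_le_spiralSum _ _ hpw hpair (by
    intro a ha
    obtain ⟨i, _, rfl⟩ := List.mem_map.1 ha
    exact hu0 _ (by omega))
  rw [adjSum_map_range, spiralSum_map_range] at hprod
  have hrefl : ∑ i ∈ range n, w i * w (i + 2) = ∑ i ∈ range n, u i * u (i + 2) := by
    rw [← Finset.sum_range_reflect]
    refine Finset.sum_congr rfl fun i hi => ?_
    rw [Finset.mem_range] at hi
    simp only [hw]
    rw [show n + 1 - (n - 1 - i) = i + 2 by omega, show n + 1 - (n - 1 - i + 2) = i by omega,
      mul_comm]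
  have hw1 : w n * w (n + 1) = u 0 * u 1 := by
    simp only [hw]
    rw [show n + 1 - n = 1 by omega, show n + 1 - (n + 1) = 0 by omega, mul_comm]
  rw [hrefl, hw1] at hprod
  -- the squares: only the two ends of the path are counted once
  have hsq : ∑ i ∈ range (n + 2), v i ^ 2 = ∑ i ∈ range (n + 2), u i ^ 2 := by
    have := ((hp.map (· ^ 2)).sum_eq)
    simp only [List.map_map] at this
    simpa [Finset.sum, Finset.range, Multiset.range, Function.comp_def] using this
  have hends : u (n + 1) ^ 2 + u n ^ 2 ≤ v 0 ^ 2 + v (n + 1) ^ 2 := by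
    have hw2 : (List.range (n + 2)).map (fun i => w i ^ 2) = w 0 ^ 2 :: w 1 ^ 2 ::
        (List.range n).map (fun i => w (i + 2) ^ 2) := by
      rw [List.range_succ_eq_map, List.range_succ_eq_map]
      simp [Function.comp_def]
    have hv2 : (List.range (n + 2)).map (fun i => v i ^ 2) = v 0 ^ 2 ::
        ((List.range n).map (fun i => v (i + 1) ^ 2) ++ [v (n + 1) ^ 2]) := by
      rw [List.range_succ_eq_map, List.range_succ]
      simp [Function.comp_def]
    have hp2 := hpw.map (· ^ 2)
    simp only [List.map_map, Function.comp_def] at hp2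
    rw [hw2, hv2] at hp2
    have hpair2 : ((List.range (n + 2)).map (fun i => w i ^ 2)).Pairwise (· ≤ ·) := by
      rw [List.pairwise_map]
      exact List.pairwise_lt_range.imp fun {a b} hab =>
        pow_le_pow_left₀ (hu0 _ (by omega)) (hanti _ _ (by omega) (by omega)) 2
    rw [hw2] at hpair2
    exact add_le_add_ends hp2 hpair2
  have e1 : ∑ i ∈ range (n + 1), edgeWeight α (v i) (v (i + 1)) =
      α * (2 * ∑ i ∈ range (n + 2), v i ^ 2 - v 0 ^ 2 - v (n + 1) ^ 2) +
        2 * (1 - α) * ∑ i ∈ range (n + 1), v i * v (i + 1) := by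
    simp only [edgeWeight, Finset.sum_add_distrib, ← Finset.mul_sum]
    have a1 := Finset.sum_range_succ (fun i => v i ^ 2) (n + 1)
    have a2 := Finset.sum_range_succ' (fun i => v i ^ 2) (n + 1)
    have a3 : 2 * ∑ i ∈ range (n + 2), v i ^ 2 - v 0 ^ 2 - v (n + 1) ^ 2 =
      ∑ i ∈ range (n + 1), v i ^ 2 + ∑ i ∈ range (n + 1), v (i + 1) ^ 2 := by linarith
    rw [a3]
  have e2 : edgeWeight α (u 0) (u 1) + ∑ i ∈ range n, edgeWeight α (u i) (u (i + 2)) =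
      α * (2 * ∑ i ∈ range (n + 2), u i ^ 2 - u (n + 1) ^ 2 - u n ^ 2) +
        2 * (1 - α) * (u 0 * u 1 + ∑ i ∈ range n, u i * u (i + 2)) := by
    simp only [edgeWeight, Finset.sum_add_distrib, ← Finset.mul_sum]
    have a1 := Finset.sum_range_succ (fun i => u i ^ 2) (n + 1)
    have a1' := Finset.sum_range_succ (fun i => u i ^ 2) n
    have a2 := Finset.sum_range_succ' (fun i => u i ^ 2) (n + 1)
    have a2' := Finset.sum_range_succ' (fun i => u (i + 1) ^ 2) n
    have a3 : 2 * ∑ i ∈ range (n + 2), u i ^ 2 - u (n + 1) ^ 2 - u n ^ 2 =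
      u 0 ^ 2 + u 1 ^ 2 + (∑ i ∈ range n, u i ^ 2 + ∑ i ∈ range n, u (i + 2) ^ 2) := by
      simp only [zero_add, add_assoc, Nat.reduceAdd] at a1 a1' a2 a2' ⊢
      linarith
    rw [a3]; ring
  rw [e1, e2, hsq]
  have h2 : 0 ≤ 2 * (1 - α) := by linarith
  have b1 := mul_le_mul_of_nonneg_left hprod h2
  have b2 := mul_le_mul_of_nonneg_left hends h0
  nlinarith

end Rearrangement

/-! ### Enumerating the edges of a graph with as many edges as vertices -/

section Enumeration

open Finset

/-- The edges from the vertices to their parents are distinct when parents have smaller rank. -/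
theorem injOn_sym2_of_rank {V : Type*} {p : V → V} {h : V → ℕ} {S : Set V}
    (hp : ∀ v ∈ S, h (p v) < h v) :
    Set.InjOn (fun v => s(v, p v)) S := by
  intro u hu v hv huv
  rcases Sym2.eq_iff.1 huv with ⟨h1, -⟩ | ⟨h1, h2⟩
  · exact h1
  · have a := hp u hu
    have b := hp v hv
    rw [h2] at a
    rw [← h1] at b
    omega

/-- The first `m + 2` terms of a sequence of vertices: for a path `c 0, …, c (m + 1)` of length
`m + 1`, its vertex set. -/
def pathFinset {V : Type*} [DecidableEq V] (c : ℕ → V) (m : ℕ) : Finset V := (range (m + 2)).image c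

theorem mem_pathFinset {V : Type*} [DecidableEq V] {c : ℕ → V} {m : ℕ} {u : V} :
    u ∈ pathFinset c m ↔ ∃ i ≤ m + 1, c i = u := by
  simp [pathFinset, Nat.lt_succ_iff]

theorem apply_mem_pathFinset {V : Type*} [DecidableEq V] (c : ℕ → V) {m i : ℕ} (hi : i ≤ m + 1) :
    c i ∈ pathFinset c m :=
  mem_pathFinset.2 ⟨i, hi, rfl⟩

/-- The index of a vertex on a path; the vertices off the path get the index `m + 2`. -/
theorem exists_index {V : Type*} [DecidableEq V] {c : ℕ → V} {m : ℕ}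
    (hc : Set.InjOn c (Set.Iic (m + 1))) :
    ∃ h : V → ℕ, (∀ i ≤ m + 1, h (c i) = i) ∧ ∀ u ∉ pathFinset c m, h u = m + 2 := by
  classical
  refine ⟨fun u => if hu : u ∈ pathFinset c m then (mem_pathFinset.1 hu).choose else m + 2,
    fun i hi => ?_, fun u hu => dif_neg hu⟩
  have hu := apply_mem_pathFinset c hi
  have := (mem_pathFinset.1 hu).choose_spec
  simp only [hu, dif_pos]
  exact hc (Set.mem_Iic.2 this.1) (Set.mem_Iic.2 hi) this.2

variable {V : Type*} [Fintype V] [DecidableEq V]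

open Classical in
/-- In a graph with as many edges as vertices, an injective choice of an edge for every vertex but
one misses exactly one edge. -/
theorem exists_extra_edge {G : SimpleGraph V} (hcard : G.edgeSet.ncard = Fintype.card V) {r : V}
    {g : V → Sym2 V} (hinj : Set.InjOn g {r}ᶜ) (hg : ∀ v, v ≠ r → g v ∈ G.edgeSet) :
    ∃ e ∈ G.edgeSet, (∀ v, v ≠ r → g v ≠ e) ∧ (∀ e' ∈ G.edgeSet, e' = e ∨ ∃ v, v ≠ r ∧ g v = e') ∧
      ∀ F : Sym2 V → ℝ, ∑ e' ∈ G.edgeFinset, F e' = F e + ∑ v ∈ univ.erase r, F (g v) := by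
  set I := (univ.erase r).image g with hI
  have hinj' : Set.InjOn g (univ.erase r : Finset V) := by
    intro a ha b hb hab
    exact hinj (by simpa using ha) (by simpa using hb) hab
  have hIsub : I ⊆ G.edgeFinset := by
    intro e he
    obtain ⟨v, hv, rfl⟩ := Finset.mem_image.1 he
    exact SimpleGraph.mem_edgeFinset.2 (hg v (Finset.ne_of_mem_erase hv))
  have hIcard : I.card = Fintype.card V - 1 := by
    rw [hI, Finset.card_image_of_injOn hinj', Finset.card_erase_of_mem (mem_univ r),
      Finset.card_univ]
  have hE : G.edgeFinset.card = Fintype.card V := by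
    rw [← hcard, Set.ncard_eq_toFinset_card', SimpleGraph.edgeFinset]
  have hpos : 0 < Fintype.card V := Fintype.card_pos_iff.2 ⟨r⟩
  have h1 : (G.edgeFinset \ I).card = 1 := by
    rw [Finset.card_sdiff_of_subset hIsub, hE, hIcard]; omega
  obtain ⟨e, he⟩ := Finset.card_eq_one.1 h1
  have hemem : e ∈ G.edgeFinset \ I := by rw [he]; exact mem_singleton_self e
  rw [mem_sdiff] at hemem
  refine ⟨e, SimpleGraph.mem_edgeFinset.1 hemem.1, fun v hv hve => hemem.2 ?_, ?_, fun F => ?_⟩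
  · exact Finset.mem_image.2 ⟨v, by simpa using hv, hve⟩
  · intro e' he'
    by_cases h : e' ∈ I
    · obtain ⟨v, hv, rfl⟩ := Finset.mem_image.1 h
      exact Or.inr ⟨v, Finset.ne_of_mem_erase hv, rfl⟩
    · have : e' ∈ G.edgeFinset \ I := mem_sdiff.2 ⟨SimpleGraph.mem_edgeFinset.2 he', h⟩
      rw [he] at this
      exact Or.inl (mem_singleton.1 this)
  · rw [← Finset.sum_sdiff hIsub, he, Finset.sum_singleton, hI, Finset.sum_image hinj']

open Classical in
/-- A known further edge is the one that `exists_extra_edge` provides. -/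
theorem edges_of_enumeration {G : SimpleGraph V} (hcard : G.edgeSet.ncard = Fintype.card V) {r : V}
    {g : V → Sym2 V} (hinj : Set.InjOn g {r}ᶜ) (hg : ∀ v, v ≠ r → g v ∈ G.edgeSet) {e : Sym2 V}
    (he : e ∈ G.edgeSet) (hge : ∀ v, v ≠ r → g v ≠ e) :
    (∀ e' ∈ G.edgeSet, e' = e ∨ ∃ v, v ≠ r ∧ g v = e') ∧
      ∀ F : Sym2 V → ℝ, ∑ e' ∈ G.edgeFinset, F e' = F e + ∑ v ∈ univ.erase r, F (g v) := by
  obtain ⟨e₀, -, -, h1, h2⟩ := exists_extra_edge hcard hinj hg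
  rcases h1 e he with rfl | ⟨v, hv, hve⟩
  · exact ⟨h1, h2⟩
  · exact absurd hve (hge v hv)

theorem sum_erase_eq_sum_path_add {c : ℕ → V} {m : ℕ} (hc : Set.InjOn c (Set.Iic (m + 1)))
    (Φ : V → ℝ) : ∑ v ∈ univ.erase (c 0), Φ v =
      ∑ i ∈ range (m + 1), Φ (c (i + 1)) + ∑ u ∈ (pathFinset c m)ᶜ, Φ u := by
  have h1 := Finset.sum_erase_add univ Φ (mem_univ (c 0))
  have h2 := Finset.sum_add_sum_compl (pathFinset c m) Φ
  have h3 : ∑ u ∈ pathFinset c m, Φ u = ∑ i ∈ range (m + 2), Φ (c i) := by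
    rw [pathFinset, Finset.sum_image]
    intro a ha b hb hab
    rw [Finset.mem_coe, Finset.mem_range] at ha hb
    exact hc (Set.mem_Iic.2 (by omega)) (Set.mem_Iic.2 (by omega)) hab
  have h4 := Finset.sum_range_succ' (fun i => Φ (c i)) (m + 1)
  linarith

end Enumeration

/-! ### Spirals -/

section Spiral

open Finset

variable {V W : Type*} [Fintype V] [DecidableEq V] [Fintype W] [DecidableEq W]

/-- A presentation of the graph `H` as a copy of the extremal graph of diameter `m + 1`: the
vertices `t 0, …, t (m + 1)` of a diametral path are listed from the middle outwards, alternately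
on both sides, all other vertices are joined to `t 0`, and one of them, `w`, also to `t 1`. There
are as many edges as vertices, so that there are no further edges. -/
structure IsSpiral (m : ℕ) (H : SimpleGraph V) (t : ℕ → V) (w : V) : Prop where
  inj : Set.InjOn t (Set.Iic (m + 1))
  notMem : w ∉ pathFinset t m
  adj_zero_one : H.Adj (t 0) (t 1)
  adj_skip : ∀ i < m, H.Adj (t i) (t (i + 2))
  adj_w : H.Adj w (t 1)
  adj_hub : ∀ u ∉ pathFinset t m, H.Adj u (t 0)
  card_edges : H.edgeSet.ncard = Fintype.card V

/-- The edges of a spiral, each in one direction. -/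
def SpiralRel (m : ℕ) (t : ℕ → V) (w u v : V) : Prop :=
  (u = t 0 ∧ v = t 1) ∨ (∃ i < m, u = t i ∧ v = t (i + 2)) ∨ (u = w ∧ v = t 1) ∨
    (u ∉ pathFinset t m ∧ v = t 0)

open Classical in
theorem IsSpiral.edges {m : ℕ} {H : SimpleGraph V} {t : ℕ → V} {w : V} (hS : IsSpiral m H t w) :
    (∀ u v, H.Adj u v ↔ SpiralRel m t w u v ∨ SpiralRel m t w v u) ∧
      ∀ F : Sym2 V → ℝ, ∑ e ∈ H.edgeFinset, F e = F s(w, t 1) + (F s(t 0, t 1) +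
        ∑ i ∈ range m, F s(t i, t (i + 2)) + ∑ u ∈ (pathFinset t m)ᶜ, F s(u, t 0)) := by
  obtain ⟨h, hh, hh'⟩ := exists_index hS.inj
  -- the edge assigned to a vertex other than `t 0` joins it to a vertex of smaller index
  set p : V → V := fun u => if h u = m + 2 then t 0 else t (h u - 2) with hp
  have hp1 : p (t 1) = t 0 := by
    have := hh 1 (by omega)
    simp [hp, this]
  have hp2 (i : ℕ) (hi : i < m) : p (t (i + 2)) = t i := by
    have := hh (i + 2) (by omega)
    simp only [hp, this]
    rw [if_neg (by omega)]; simp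
  have hpu (u : V) (hu : u ∉ pathFinset t m) : p u = t 0 := by simp [hp, hh' u hu]
  have hcases (v : V) (hv : v ≠ t 0) : v = t 1 ∨ (∃ i < m, v = t (i + 2)) ∨
      v ∉ pathFinset t m := by
    by_cases hvm : v ∈ pathFinset t m
    · obtain ⟨i, hi, rfl⟩ := mem_pathFinset.1 hvm
      rcases i with _ | _ | i
      · exact absurd rfl hv
      · exact Or.inl rfl
      · exact Or.inr (Or.inl ⟨i, by omega, rfl⟩)
    · exact Or.inr (Or.inr hvm)
  have hrank (v : V) (hv : v ≠ t 0) : h (p v) < h v := by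
    rcases hcases v hv with rfl | ⟨i, hi, rfl⟩ | hvm
    · rw [hp1, hh 0 (by omega), hh 1 (by omega)]; omega
    · rw [hp2 i hi, hh i (by omega), hh (i + 2) (by omega)]; omega
    · rw [hpu v hvm, hh 0 (by omega), hh' v hvm]; omega
  have hinj : Set.InjOn (fun v => s(v, p v)) {t 0}ᶜ := injOn_sym2_of_rank (h := h) fun v hv =>
    hrank v hv
  have hadj (v : V) (hv : v ≠ t 0) : s(v, p v) ∈ H.edgeSet := by
    rw [SimpleGraph.mem_edgeSet]
    rcases hcases v hv with rfl | ⟨i, hi, rfl⟩ | hvm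
    · rw [hp1]; exact hS.adj_zero_one.symm
    · rw [hp2 i hi]; exact (hS.adj_skip i hi).symm
    · rw [hpu v hvm]; exact hS.adj_hub v hvm
  have ht01 : t 0 ≠ t 1 := hS.adj_zero_one.ne
  have hw0 : w ≠ t 0 := fun h => hS.notMem (h ▸ apply_mem_pathFinset t (by omega))
  have hne (v : V) (hv : v ≠ t 0) : s(v, p v) ≠ s(w, t 1) := by
    intro h
    rcases Sym2.eq_iff.1 h with ⟨rfl, h2⟩ | ⟨rfl, h2⟩
    · rw [hpu v hS.notMem] at h2; exact ht01 h2
    · rw [hp1] at h2; exact hw0 h2.symm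
  obtain ⟨h1, h2⟩ := edges_of_enumeration hS.card_edges hinj hadj
    ((SimpleGraph.mem_edgeSet H).2 hS.adj_w) hne
  constructor
  · have hRel (u v : V) (huv : SpiralRel m t w u v) : H.Adj u v := by
      rcases huv with ⟨rfl, rfl⟩ | ⟨i, hi, rfl, rfl⟩ | ⟨rfl, rfl⟩ | ⟨hu, rfl⟩
      · exact hS.adj_zero_one
      · exact hS.adj_skip i hi
      · exact hS.adj_w
      · exact hS.adj_hub u hu
    refine fun u v => ⟨fun huv => ?_, ?_⟩
    · have key (v : V) (hv : v ≠ t 0) : SpiralRel m t w v (p v) ∨ SpiralRel m t w (p v) v := by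
        rcases hcases v hv with rfl | ⟨i, hi, rfl⟩ | hvm
        · rw [hp1]; exact Or.inr (Or.inl ⟨rfl, rfl⟩)
        · rw [hp2 i hi]; exact Or.inr (Or.inr (Or.inl ⟨i, hi, rfl, rfl⟩))
        · rw [hpu v hvm]; exact Or.inl (Or.inr (Or.inr (Or.inr ⟨hvm, rfl⟩)))
      rcases h1 s(u, v) huv with h | ⟨x, hx, h⟩
      · rcases Sym2.eq_iff.1 h with ⟨rfl, rfl⟩ | ⟨rfl, rfl⟩
        · exact Or.inl (Or.inr (Or.inr (Or.inl ⟨rfl, rfl⟩)))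
        · exact Or.inr (Or.inr (Or.inr (Or.inl ⟨rfl, rfl⟩)))
      · rcases Sym2.eq_iff.1 h with ⟨rfl, rfl⟩ | ⟨rfl, rfl⟩
        · exact key x hx
        · exact (key x hx).symm
    · rintro (h | h)
      · exact hRel u v h
      · exact (hRel v u h).symm
  · intro F
    rw [h2, sum_erase_eq_sum_path_add hS.inj (fun v => F s(v, p v)), Finset.sum_range_succ']
    have a1 : ∑ i ∈ range m, F s(t (i + 1 + 1), p (t (i + 1 + 1))) =
        ∑ i ∈ range m, F s(t i, t (i + 2)) :=
      Finset.sum_congr rfl fun i hi => by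
        rw [hp2 i (Finset.mem_range.1 hi), Sym2.eq_swap]
    have a2 : ∑ u ∈ (pathFinset t m)ᶜ, F s(u, p u) = ∑ u ∈ (pathFinset t m)ᶜ, F s(u, t 0) :=
      Finset.sum_congr rfl fun u hu => by rw [hpu u (Finset.mem_compl.1 hu)]
    rw [a1, a2]
    simp only [zero_add]
    rw [hp1, Sym2.eq_swap (a := t 1)]
    ring

/-- A bijection that matches the parameters of two spirals. -/
theorem exists_equiv_of_paths {m : ℕ} (hcard : Fintype.card V = Fintype.card W) {t : ℕ → V}
    {t' : ℕ → W} {w : V} {w' : W} (ht : Set.InjOn t (Set.Iic (m + 1))) (hw : w ∉ pathFinset t m)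
    (ht' : Set.InjOn t' (Set.Iic (m + 1))) (hw' : w' ∉ pathFinset t' m) :
    ∃ φ : V ≃ W, (∀ i ≤ m + 1, φ (t i) = t' i) ∧ φ w = w' := by
  obtain ⟨h, hh, hh'⟩ := exists_index ht
  set f : V → W := fun u => if h u = m + 2 then w' else t' (h u) with hf
  have hft (i : ℕ) (hi : i ≤ m + 1) : f (t i) = t' i := by
    simp only [hf, hh i hi]
    rw [if_neg (by omega)]
  have hfw : f w = w' := by simp [hf, hh' w hw]
  have hinj : Set.InjOn f (insert w (pathFinset t m) : Finset V) := by
    intro a ha b hb hab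
    rw [Finset.mem_coe, Finset.mem_insert] at ha hb
    rcases ha with rfl | ha <;> rcases hb with rfl | hb
    · rfl
    · obtain ⟨i, hi, rfl⟩ := mem_pathFinset.1 hb
      rw [hfw, hft i hi] at hab
      exact absurd (hab ▸ apply_mem_pathFinset t' hi) hw'
    · obtain ⟨i, hi, rfl⟩ := mem_pathFinset.1 ha
      rw [hfw, hft i hi] at hab
      exact absurd (hab ▸ apply_mem_pathFinset t' hi) hw'
    · obtain ⟨i, hi, rfl⟩ := mem_pathFinset.1 ha
      obtain ⟨j, hj, rfl⟩ := mem_pathFinset.1 hb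
      rw [hft i hi, hft j hj] at hab
      rw [ht' (Set.mem_Iic.2 hi) (Set.mem_Iic.2 hj) hab]
  obtain ⟨g, hg⟩ := Finset.exists_equiv_extend_of_card_eq (t := (univ : Finset W))
    (by rw [hcard, Finset.card_univ]) (Finset.subset_univ _) hinj
  refine ⟨g.trans (Equiv.subtypeUnivEquiv (fun x => mem_univ x)), fun i hi => ?_, ?_⟩
  · rw [← hft i hi]
    exact hg _ (Finset.mem_insert_of_mem (apply_mem_pathFinset t hi))
  · rw [← hfw]
    exact hg _ (Finset.mem_insert_self _ _)

theorem IsSpiral.iso {m : ℕ} {G : SimpleGraph V} {H : SimpleGraph W} {t : ℕ → V} {t' : ℕ → W}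
    {w : V} {w' : W} (hcard : Fintype.card V = Fintype.card W) (hG : IsSpiral m G t w)
    (hH : IsSpiral m H t' w') : Nonempty (G ≃g H) := by
  obtain ⟨φ, hφ, hφw⟩ := exists_equiv_of_paths hcard hG.inj hG.notMem hH.inj hH.notMem
  have hmem (u : V) : φ u ∈ pathFinset t' m ↔ u ∈ pathFinset t m := by
    rw [mem_pathFinset, mem_pathFinset]
    refine exists_congr fun i => and_congr_right fun hi => ?_
    rw [← hφ i hi, φ.injective.eq_iff]
  have hrel (u v : V) : SpiralRel m t' w' (φ u) (φ v) ↔ SpiralRel m t w u v := by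
    unfold SpiralRel
    rw [hmem, ← hφ 0 (by omega), ← hφ 1 (by omega), ← hφw]
    simp only [φ.injective.eq_iff]
    refine or_congr Iff.rfl (or_congr (exists_congr fun i => and_congr_right fun hi => ?_) Iff.rfl)
    rw [← hφ i (by omega), ← hφ (i + 2) (by omega), φ.injective.eq_iff, φ.injective.eq_iff]
  exact ⟨⟨φ, by
    intro u v
    rw [hG.edges.1, hH.edges.1, hrel, hrel]⟩⟩

/-- A spiral can be transported to any prescribed parameters. -/
theorem IsSpiral.exists_copy {m : ℕ} {H : SimpleGraph W} {t' : ℕ → W} {w' : W}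
    (hH : IsSpiral m H t' w') (hcard : Fintype.card V = Fintype.card W) {t : ℕ → V} {w : V}
    (ht : Set.InjOn t (Set.Iic (m + 1))) (hw : w ∉ pathFinset t m) :
    ∃ H' : SimpleGraph V, IsSpiral m H' t w ∧ Nonempty (H' ≃g H) := by
  obtain ⟨φ, hφ, hφw⟩ := exists_equiv_of_paths hcard ht hw hH.inj hH.notMem
  have hmem (u : V) : φ u ∈ pathFinset t' m ↔ u ∈ pathFinset t m := by
    rw [mem_pathFinset, mem_pathFinset]
    refine exists_congr fun i => and_congr_right fun hi => ?_
    rw [← hφ i hi, φ.injective.eq_iff]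
  set ψ : H.comap φ ≃g H := SimpleGraph.Iso.comap φ H
  refine ⟨H.comap φ, ⟨ht, hw, ?_, fun i hi => ?_, ?_, fun u hu => ?_, ?_⟩, ⟨ψ⟩⟩
  · rw [SimpleGraph.comap_adj, hφ 0 (by omega), hφ 1 (by omega)]; exact hH.adj_zero_one
  · rw [SimpleGraph.comap_adj, hφ i (by omega), hφ (i + 2) (by omega)]; exact hH.adj_skip i hi
  · rw [SimpleGraph.comap_adj, hφw, hφ 1 (by omega)]; exact hH.adj_w
  · rw [SimpleGraph.comap_adj, hφ 0 (by omega)]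
    exact hH.adj_hub _ (by rwa [hmem])
  · rw [hcard, ← hH.card_edges, ← Nat.card_coe_set_eq, ← Nat.card_coe_set_eq]
    exact Nat.card_congr ψ.mapEdgeSet

end Spiral

/-! ### The extremal graph -/

section Delta2

open Finset

/-- The neighbour of a vertex of `delta2 s a b` on the way to `w₂`; the triangle edge `w₁ w₃` is
not used. The value at `w₂` itself is irrelevant. -/
def delta2Parent (s a b : ℕ) : Delta2Vertex s a b → Delta2Vertex s a b
  | .inl _ => .inl 1
  | .inr (.inl _) => .inl 1
  | .inr (.inr (.inl i)) => if i.val = 0 then .inl 1 else .inr (.inr (.inl ⟨i - 1, by omega⟩))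
  | .inr (.inr (.inr i)) => if i.val = 0 then .inl 2 else .inr (.inr (.inr ⟨i - 1, by omega⟩))

/-- The distance of a vertex of `delta2 s a b` to `w₂`. -/
def delta2Rank (s a b : ℕ) : Delta2Vertex s a b → ℕ
  | .inl w => if w = 1 then 0 else 1
  | .inr (.inl _) => 1
  | .inr (.inr (.inl i)) => i + 1
  | .inr (.inr (.inr i)) => i + 2

/-- A coordinate on `delta2 s a b` along its diametral path, with origin `w₂`. -/
def delta2Coord (s a b : ℕ) : Delta2Vertex s a b → ℤ
  | .inl w => if w = 2 then 1 else 0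
  | .inr (.inl _) => 0
  | .inr (.inr (.inl i)) => -(i + 1)
  | .inr (.inr (.inr i)) => i + 2

variable {s a b : ℕ}

theorem delta2_adj_iff (u v : Delta2Vertex s a b) : (delta2 s a b).Adj u v ↔
    u ≠ v ∧ (delta2Rel s a b u v ∨ delta2Rel s a b v u) := by
  simp [delta2, SimpleGraph.fromRel_adj]

theorem delta2_adj_parent (v : Delta2Vertex s a b) (hv : v ≠ .inl 1) :
    (delta2 s a b).Adj v (delta2Parent s a b v) := by
  rw [delta2_adj_iff]
  rcases v with w | i | i | i
  · simp_all [delta2Parent, delta2Rel]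
  · simp [delta2Parent, delta2Rel]
  · by_cases hi : i.val = 0
    · simp [delta2Parent, delta2Rel, hi]
    · simp [delta2Parent, delta2Rel, hi, Fin.ext_iff]; omega
  · by_cases hi : i.val = 0
    · simp [delta2Parent, delta2Rel, hi]
    · simp [delta2Parent, delta2Rel, hi, Fin.ext_iff]; omega

theorem delta2Rank_parent (v : Delta2Vertex s a b) (hv : v ≠ .inl 1) :
    delta2Rank s a b v = delta2Rank s a b (delta2Parent s a b v) + 1 := by
  rcases v with w | i | i | i
  · have : w ≠ 1 := fun h => hv (by rw [h])
    simp [delta2Parent, delta2Rank, this]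
  · simp [delta2Parent, delta2Rank]
  · by_cases hi : i.val = 0
    · simp [delta2Parent, delta2Rank, hi]
    · simp [delta2Parent, delta2Rank, hi]; omega
  · by_cases hi : i.val = 0
    · simp [delta2Parent, delta2Rank, hi]
    · simp [delta2Parent, delta2Rank, hi]; omega

theorem delta2_edge_cases {u v : Delta2Vertex s a b} (huv : delta2Rel s a b u v) (hne : u ≠ v) :
    s(u, v) = s(.inl 0, .inl 2) ∨ (u ≠ .inl 1 ∧ v = delta2Parent s a b u) ∨
      (v ≠ .inl 1 ∧ u = delta2Parent s a b v) := by
  rcases u with w | i | i | i <;> rcases v with w' | j | j | j <;>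
    simp only [delta2Rel] at huv
  · fin_cases w <;> fin_cases w' <;> simp_all [delta2Parent]
  · simp [huv, delta2Parent]
  · simp [huv, delta2Parent]
  · simp [huv, delta2Parent]
  · refine Or.inr (Or.inr ⟨by simp, ?_⟩)
    simp [delta2Parent, huv]
  · refine Or.inr (Or.inr ⟨by simp, ?_⟩)
    simp [delta2Parent, huv]

theorem delta2_edgeSet : (delta2 s a b).edgeSet =
    insert s(.inl 0, .inl 2) ((fun v => s(v, delta2Parent s a b v)) '' {.inl 1}ᶜ) := by
  ext e
  induction e with | _ u v =>
  rw [SimpleGraph.mem_edgeSet, Set.mem_insert_iff, Set.mem_image]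
  constructor
  · intro h
    obtain ⟨hne, h | h⟩ := (delta2_adj_iff u v).1 h
    · rcases delta2_edge_cases h hne with h | ⟨h1, h2⟩ | ⟨h1, h2⟩
      · exact Or.inl h
      · exact Or.inr ⟨u, h1, by rw [h2]⟩
      · exact Or.inr ⟨v, h1, by rw [h2, Sym2.eq_swap]⟩
    · rcases delta2_edge_cases h hne.symm with h | ⟨h1, h2⟩ | ⟨h1, h2⟩
      · exact Or.inl (by rw [Sym2.eq_swap, h])
      · exact Or.inr ⟨v, h1, by rw [h2, Sym2.eq_swap]⟩
      · exact Or.inr ⟨u, h1, by rw [h2]⟩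
  · rintro (h | ⟨x, hx, h⟩)
    · have : (delta2 s a b).Adj (.inl 0) (.inl 2) := by simp [delta2_adj_iff, delta2Rel]
      rw [← SimpleGraph.mem_edgeSet, h]; exact this
    · rw [← SimpleGraph.mem_edgeSet, ← h]
      exact delta2_adj_parent x hx

theorem delta2_card_edges :
    (delta2 s a b).edgeSet.ncard = Fintype.card (Delta2Vertex s a b) := by
  have hinj : Set.InjOn (fun v => s(v, delta2Parent s a b v)) {.inl 1}ᶜ :=
    injOn_sym2_of_rank (h := delta2Rank s a b) fun v hv => by
      have := delta2Rank_parent v hv; omega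
  rw [delta2_edgeSet, Set.ncard_insert_of_notMem, hinj.ncard_image,
    Set.ncard_compl, Set.ncard_singleton, Nat.card_eq_fintype_card]
  · have : 0 < Fintype.card (Delta2Vertex s a b) := Fintype.card_pos_iff.2 ⟨.inl 0⟩
    omega
  · rintro ⟨x, hx, h⟩
    rcases Sym2.eq_iff.1 h with ⟨rfl, h⟩ | ⟨rfl, h⟩ <;> simp [delta2Parent] at h

theorem delta2_reachable (v : Delta2Vertex s a b) :
    ∃ p : (delta2 s a b).Walk v (.inl 1), p.length = delta2Rank s a b v := by
  induction hn : delta2Rank s a b v using Nat.strong_induction_on generalizing v with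
  | _ n ih =>
    by_cases hv : v = .inl 1
    · subst hv; exact ⟨.nil, by simp [← hn, delta2Rank]⟩
    · have h := delta2Rank_parent v hv
      obtain ⟨p, hp⟩ := ih (delta2Rank s a b (delta2Parent s a b v)) (by omega) _ rfl
      exact ⟨.cons (delta2_adj_parent v hv) p, by rw [SimpleGraph.Walk.length_cons]; omega⟩

theorem delta2_connected : (delta2 s a b).Connected := by
  rw [SimpleGraph.connected_iff_exists_forall_reachable]
  exact ⟨.inl 1, fun v => ((delta2_reachable v).choose.reachable).symm⟩

theorem delta2_dist_le_rank (v : Delta2Vertex s a b) :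
    (delta2 s a b).dist v (.inl 1) ≤ delta2Rank s a b v := by
  obtain ⟨p, hp⟩ := delta2_reachable v
  rw [← hp]; exact SimpleGraph.dist_le p

theorem delta2_dist_w₃ (i : Fin b) :
    (delta2 s a b).dist (.inr (.inr (.inr i))) (.inl 2) ≤ i + 1 := by
  obtain ⟨i, hi⟩ := i
  induction i with
  | zero =>
    have h : (delta2 s a b).Adj (.inr (.inr (.inr ⟨0, hi⟩))) (.inl 2) := by
      simp [delta2_adj_iff, delta2Rel]
    exact (SimpleGraph.dist_eq_one_iff_adj.2 h).le
  | succ i ih =>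
    have h : (delta2 s a b).Adj (.inr (.inr (.inr ⟨i + 1, hi⟩)))
        (.inr (.inr (.inr ⟨i, by omega⟩))) := by
      simp [delta2_adj_iff, delta2Rel]
    have h1 := SimpleGraph.dist_eq_one_iff_adj.2 h
    have h2 := ih (by omega)
    have h3 := delta2_connected.dist_triangle (u := .inr (.inr (.inr ⟨i + 1, hi⟩)))
      (v := .inr (.inr (.inr ⟨i, by omega⟩))) (w := .inl 2) (G := delta2 s a b)
    simp only at h2 ⊢
    omega

theorem delta2_dist_le (hb : b ≤ a) (ha : a ≤ b + 1) (hab : 1 ≤ a) (u v : Delta2Vertex s a b) :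
    (delta2 s a b).dist u v ≤ a + b + 1 := by
  have hu := delta2_dist_le_rank u
  have hv := delta2_dist_le_rank v
  have htri := delta2_connected.dist_triangle (u := u) (v := .inl 1) (w := v)
    (G := delta2 s a b)
  rw [(delta2 s a b).dist_comm (u := .inl 1) (v := v)] at htri
  have key : delta2Rank s a b u + delta2Rank s a b v ≤ a + b + 1 ∨
      ∃ i j, u = .inr (.inr (.inr i)) ∧ v = .inr (.inr (.inr j)) := by
    have hw (w : Fin 3) : delta2Rank s a b (.inl w) ≤ 1 := by
      simp only [delta2Rank]; split_ifs <;> omega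
    rcases u with w | i | i | i <;> rcases v with w' | j | j | j
    case inr.inr.inr.inr.inr.inr => exact Or.inr ⟨i, j, rfl, rfl⟩
    all_goals left
    all_goals try have := hw w
    all_goals try have := hw w'
    all_goals simp only [delta2Rank] at *
    all_goals omega
  rcases key with h | ⟨i, j, rfl, rfl⟩
  · omega
  · have hi := delta2_dist_w₃ (s := s) (a := a) i
    have hj := delta2_dist_w₃ (s := s) (a := a) j
    have h3 := delta2_connected.dist_triangle (u := .inr (.inr (.inr i))) (v := .inl 2)
      (w := .inr (.inr (.inr j))) (G := delta2 s a b)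
    rw [(delta2 s a b).dist_comm (u := .inl 2)] at h3
    have := i.isLt
    have := j.isLt
    omega

theorem delta2Coord_rel {u v : Delta2Vertex s a b} (huv : delta2Rel s a b u v) :
    |delta2Coord s a b u - delta2Coord s a b v| ≤ 1 := by
  rcases u with w | i | i | i <;> rcases v with w' | j | j | j <;>
    simp only [delta2Rel] at huv
  · fin_cases w <;> fin_cases w' <;> simp [delta2Coord]
  all_goals simp [delta2Coord, huv]

theorem delta2Coord_le_dist (u v : Delta2Vertex s a b) :
    |delta2Coord s a b u - delta2Coord s a b v| ≤ (delta2 s a b).dist u v := by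
  obtain ⟨p, hp⟩ := delta2_connected.exists_walk_length_eq_dist u v
  rw [← hp]
  clear hp
  induction p with
  | nil => simp
  | @cons u x v h p ih =>
    have h1 : |delta2Coord s a b u - delta2Coord s a b x| ≤ 1 := by
      obtain ⟨-, h | h⟩ := (delta2_adj_iff u x).1 h
      · exact delta2Coord_rel h
      · rw [abs_sub_comm]; exact delta2Coord_rel h
    have h2 := abs_sub_le (delta2Coord s a b u) (delta2Coord s a b x) (delta2Coord s a b v)
    rw [SimpleGraph.Walk.length_cons]
    push_cast
    linarith

theorem delta2_diam (hb : b ≤ a) (ha : a ≤ b + 1) (hab : 1 ≤ a) :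
    (delta2 s a b).diam = a + b + 1 := by
  have hne : (delta2 s a b).ediam ≠ ⊤ :=
    SimpleGraph.connected_iff_ediam_ne_top.1 delta2_connected
  refine le_antisymm ?_ ?_
  · obtain ⟨u, v, huv⟩ := (delta2 s a b).exists_dist_eq_diam
    rw [← huv]; exact delta2_dist_le hb ha hab u v
  · have h1 (u v) := delta2Coord_le_dist (s := s) (a := a) (b := b) u v
    obtain ⟨v, hv⟩ : ∃ v : Delta2Vertex s a b, delta2Coord s a b v = b + 1 := by
      rcases Nat.eq_zero_or_pos b with rfl | hb'
      · exact ⟨.inl 2, by simp [delta2Coord]⟩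
      · refine ⟨.inr (.inr (.inr ⟨b - 1, by omega⟩)), ?_⟩
        simp only [delta2Coord]; omega
    have h2 := h1 (.inr (.inr (.inl ⟨a - 1, by omega⟩))) v
    have h3 := SimpleGraph.dist_le_diam hne (u := .inr (.inr (.inl ⟨a - 1, by omega⟩))) (v := v)
    rw [hv, abs_sub_comm] at h2
    have h4 := (le_abs_self _).trans h2
    simp only [delta2Coord] at h4
    omega

/-- The vertices of the diametral path of `delta2 s a b` from the middle outwards, alternately on
both sides: `w₂`, `w₃`, and then the vertices of the two pendant paths. -/
def delta2Path (s a b : ℕ) (i : ℕ) : Delta2Vertex s a b :=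
  if i = 0 then .inl 1 else if i = 1 then .inl 2 else
    if i % 2 = 0 then (if h : (i - 2) / 2 < a then .inr (.inr (.inl ⟨(i - 2) / 2, h⟩)) else .inl 0)
    else (if h : (i - 2) / 2 < b then .inr (.inr (.inr ⟨(i - 2) / 2, h⟩)) else .inl 0)

theorem delta2Path_even {j : ℕ} (hj : j < a) :
    delta2Path s a b (2 * j + 2) = .inr (.inr (.inl ⟨j, hj⟩)) := by
  simp [delta2Path, hj]

theorem delta2Path_odd {j : ℕ} (hj : j < b) :
    delta2Path s a b (2 * j + 3) = .inr (.inr (.inr ⟨j, hj⟩)) := by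
  have h1 : (2 * j + 1) / 2 = j := by omega
  have h2 : (2 * j + 3) % 2 = 1 := by omega
  simp [delta2Path, h1, h2, hj]

theorem delta2Path_cases (hb : b ≤ a) (ha : a ≤ b + 1) {i : ℕ} (hi : i ≤ a + b + 1) :
    i = 0 ∨ i = 1 ∨ (∃ j, j < a ∧ i = 2 * j + 2) ∨ (∃ j, j < b ∧ i = 2 * j + 3) := by
  rcases Nat.even_or_odd' i with ⟨k, rfl | rfl⟩
  · rcases k with _ | k
    · exact Or.inl rfl
    · exact Or.inr (Or.inr (Or.inl ⟨k, by omega, by omega⟩))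
  · rcases k with _ | k
    · exact Or.inr (Or.inl rfl)
    · exact Or.inr (Or.inr (Or.inr ⟨k, by omega, by omega⟩))

/-- The extremal graph of the statement is a spiral. -/
theorem delta2_isSpiral (hb : b ≤ a) (ha : a ≤ b + 1) :
    IsSpiral (a + b) (delta2 s a b) (delta2Path s a b) (.inl 0) := by
  have h0 : delta2Path s a b 0 = .inl 1 := rfl
  have h1 : delta2Path s a b 1 = .inl 2 := rfl
  have hcase {i : ℕ} (hi : i ≤ a + b + 1) := delta2Path_cases hb ha hi
  refine ⟨fun i hi j hj hij => ?_, fun h => ?_, ?_, fun i hi => ?_, ?_, fun u hu => ?_,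
    delta2_card_edges⟩
  · rcases hcase hi with rfl | rfl | ⟨k, hk, rfl⟩ | ⟨k, hk, rfl⟩ <;>
    rcases hcase hj with rfl | rfl | ⟨l, hl, rfl⟩ | ⟨l, hl, rfl⟩ <;>
    simp_all [delta2Path_even, delta2Path_odd]
  · obtain ⟨i, hi, h⟩ := mem_pathFinset.1 h
    rcases hcase hi with rfl | rfl | ⟨k, hk, rfl⟩ | ⟨k, hk, rfl⟩ <;>
    simp_all [delta2Path_even, delta2Path_odd]
  · simp [h0, h1, delta2_adj_iff, delta2Rel]
  · rcases hcase (show i + 2 ≤ a + b + 1 by omega) with h | h | ⟨k, hk, h⟩ | ⟨k, hk, h⟩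
    · omega
    · omega
    · rw [h, delta2Path_even hk]
      rcases k with _ | k
      · obtain rfl : i = 0 := by omega
        simp [h0, delta2_adj_iff, delta2Rel]
      · obtain rfl : i = 2 * k + 2 := by omega
        rw [delta2Path_even (by omega)]
        simp [delta2_adj_iff, delta2Rel]
    · rw [h, delta2Path_odd hk]
      rcases k with _ | k
      · obtain rfl : i = 1 := by omega
        simp [h1, delta2_adj_iff, delta2Rel]
      · obtain rfl : i = 2 * k + 3 := by omega
        rw [delta2Path_odd (by omega)]
        simp [delta2_adj_iff, delta2Rel]
  · simp [h1, delta2_adj_iff, delta2Rel]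
  · rw [h0]
    rcases u with w | i | i | i
    · have hw1 : w ≠ 1 := by
        rintro rfl; exact hu (mem_pathFinset.2 ⟨0, by omega, h0⟩)
      simp [delta2_adj_iff, delta2Rel, hw1]
    · simp [delta2_adj_iff, delta2Rel]
    · exact absurd (mem_pathFinset.2 ⟨_, by omega, delta2Path_even i.isLt⟩) hu
    · exact absurd (mem_pathFinset.2 ⟨_, by omega, delta2Path_odd i.isLt⟩) hu

end Delta2

/-! ### Geodesics -/

section Geodesic

open Finset

variable {V : Type*}

/-- `c 0, …, c (m + 1)` is a path of length `m + 1` that realizes the distance of its ends. -/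
structure IsGeodesic (m : ℕ) (G : SimpleGraph V) (c : ℕ → V) : Prop where
  adj : ∀ i ≤ m, G.Adj (c i) (c (i + 1))
  dist : G.dist (c 0) (c (m + 1)) = m + 1

variable {m : ℕ} {G : SimpleGraph V} {c : ℕ → V}

theorem IsGeodesic.dist_eq (hc : IsGeodesic m G c) (hG : G.Connected) {i j : ℕ} (hij : i ≤ j)
    (hj : j ≤ m + 1) : G.dist (c i) (c j) = j - i := by
  have hle (i k : ℕ) (hk : i + k ≤ m + 1) : G.dist (c i) (c (i + k)) ≤ k := by
    induction k with
    | zero => simp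
    | succ k ih =>
      have h1 := ih (by omega)
      have h2 := SimpleGraph.dist_eq_one_iff_adj.2 (hc.adj (i + k) (by omega))
      have h3 := hG.dist_triangle (u := c i) (v := c (i + k)) (w := c (i + k + 1))
      rw [← add_assoc]; omega
  have h1 := hle 0 i (by omega)
  have h2 := hle i (j - i) (by omega)
  have h3 := hle j (m + 1 - j) (by omega)
  rw [show i + (j - i) = j by omega] at h2
  rw [show j + (m + 1 - j) = m + 1 by omega] at h3
  rw [zero_add] at h1
  have h4 := hG.dist_triangle (u := c 0) (v := c i) (w := c (m + 1))
  have h5 := hG.dist_triangle (u := c i) (v := c j) (w := c (m + 1))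
  have h6 := hc.dist
  omega

theorem IsGeodesic.injOn (hc : IsGeodesic m G c) (hG : G.Connected) :
    Set.InjOn c (Set.Iic (m + 1)) := by
  intro i hi j hj hij
  rw [Set.mem_Iic] at hi hj
  rcases le_total i j with h | h
  · have := hc.dist_eq hG h hj
    rw [hij, SimpleGraph.dist_self] at this; omega
  · have := hc.dist_eq hG h hi
    rw [hij, SimpleGraph.dist_self] at this; omega

theorem IsGeodesic.adj_iff (hc : IsGeodesic m G c) (hG : G.Connected) {i j : ℕ}
    (hi : i ≤ m + 1) (hj : j ≤ m + 1) : G.Adj (c i) (c j) ↔ j = i + 1 ∨ i = j + 1 := by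
  rw [← SimpleGraph.dist_eq_one_iff_adj]
  rcases le_total i j with h | h
  · rw [hc.dist_eq hG h hj]; omega
  · rw [SimpleGraph.dist_comm, hc.dist_eq hG h hi]; omega

theorem IsGeodesic.reverse (hc : IsGeodesic m G c) :
    IsGeodesic m G (fun i => c (m + 1 - i)) := by
  refine ⟨fun i hi => ?_, ?_⟩
  · have := hc.adj (m - i) (by omega)
    rw [show m - i + 1 = m + 1 - i by omega] at this
    rw [show m + 1 - (i + 1) = m - i by omega]
    exact this.symm
  · simp only [Nat.sub_zero, Nat.sub_self]
    rw [SimpleGraph.dist_comm]; exact hc.dist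

theorem pathFinset_reverse [DecidableEq V] (c : ℕ → V) (m : ℕ) :
    pathFinset (fun i => c (m + 1 - i)) m = pathFinset c m := by
  ext u
  rw [mem_pathFinset, mem_pathFinset]
  constructor
  · rintro ⟨i, hi, rfl⟩; exact ⟨m + 1 - i, by omega, rfl⟩
  · rintro ⟨i, hi, rfl⟩
    exact ⟨m + 1 - i, by omega, by rw [show m + 1 - (m + 1 - i) = i by omega]⟩

theorem exists_isGeodesic [Finite V] (hG : G.Connected) (hd : G.diam = m + 1) :
    ∃ c, IsGeodesic m G c := by
  have := hG.nonempty
  obtain ⟨u, v, huv⟩ := G.exists_dist_eq_diam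
  obtain ⟨p, hp⟩ := hG.exists_walk_length_eq_dist u v
  have hlen : p.length = m + 1 := by rw [hp, huv, hd]
  refine ⟨p.getVert, fun i hi => p.adj_getVert_succ (by omega), ?_⟩
  rw [p.getVert_zero, ← hlen, p.getVert_length, hp]

/-- A breadth-first search tree rooted at the start of a geodesic that contains the geodesic. -/
theorem exists_parents [DecidableEq V] (hc : IsGeodesic m G c) (hG : G.Connected) :
    ∃ p : V → V, (∀ i ≤ m, p (c (i + 1)) = c i) ∧
      ∀ v, v ≠ c 0 → G.Adj v (p v) ∧ G.dist (c 0) (p v) < G.dist (c 0) v := by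
  have hstep (v : V) (hv : v ≠ c 0) : ∃ u, G.Adj v u ∧ G.dist (c 0) u < G.dist (c 0) v := by
    obtain ⟨p, hp⟩ := hG.exists_walk_length_eq_dist v (c 0)
    cases p with
    | nil => exact absurd rfl hv
    | @cons _ u _ h p =>
      refine ⟨u, h, ?_⟩
      rw [SimpleGraph.dist_comm, G.dist_comm (u := c 0), ← hp, SimpleGraph.Walk.length_cons]
      exact Nat.lt_succ_of_le (SimpleGraph.dist_le p)
  choose! q hq using hstep
  obtain ⟨h, hh, hh'⟩ := exists_index (hc.injOn hG)
  have hpath (i : ℕ) (hi : i ≤ m) : c (i + 1) ∈ pathFinset c m :=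
    apply_mem_pathFinset c (by omega)
  refine ⟨fun v => if v ∈ pathFinset c m then c (h v - 1) else q v, fun i hi => ?_,
    fun v hv => ?_⟩
  · simp only [hpath i hi, if_true, hh (i + 1) (by omega), Nat.add_sub_cancel]
  · by_cases hvm : v ∈ pathFinset c m
    · obtain ⟨i, hi, rfl⟩ := mem_pathFinset.1 hvm
      rcases i with _ | i
      · exact absurd rfl hv
      simp only [hvm, if_true, hh (i + 1) hi, Nat.add_sub_cancel]
      refine ⟨(hc.adj i (by omega)).symm, ?_⟩
      rw [hc.dist_eq hG (Nat.zero_le _) (by omega), hc.dist_eq hG (Nat.zero_le _) hi]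
      omega
    · simp only [hvm, if_false]
      exact hq v hv

/-- Parents for the vertices of `G` when a vertex `r` off the path `c` serves as a second root: the
component of `r` in the complement of the path is rooted at `r`, the other vertices are rooted at
`c 0`, and the edge `s(w, q)` joins this component to the path. -/
theorem exists_parents_of_notMem [DecidableEq V] (hc : IsGeodesic m G c) (hG : G.Connected) {r : V}
    (hr : r ∉ pathFinset c m) : ∃ (p : V → V) (w q : V), (∀ i ≤ m, p (c (i + 1)) = c i) ∧
      (∀ v, v ≠ c 0 → v ≠ r → G.Adj v (p v)) ∧ w ∉ pathFinset c m ∧ q ∈ pathFinset c m ∧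
      G.Adj w q ∧ Set.InjOn (fun v => s(v, p v)) {v | v ≠ c 0 ∧ v ≠ r} ∧
      ∀ v, v ≠ c 0 → v ≠ r → s(v, p v) ≠ s(w, q) := by
  classical
  obtain ⟨p, hp, hp'⟩ := exists_parents hc hG
  set G₁ : SimpleGraph V :=
    { Adj := fun u v => G.Adj u v ∧ u ∉ pathFinset c m ∧ v ∉ pathFinset c m
      symm := ⟨fun u v h => ⟨h.1.symm, h.2.2, h.2.1⟩⟩
      loopless := ⟨fun u h => h.1.ne rfl⟩ } with hG₁
  set K : Set V := {u | G₁.Reachable u r} with hK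
  have hrK : r ∈ K := SimpleGraph.Reachable.refl r
  have hKP (u : V) (hu : u ∈ K) : u ∉ pathFinset c m := by
    obtain ⟨p⟩ := hu
    cases p with
    | nil => exact hr
    | cons h _ => exact h.2.1
  have hstep (v : V) (hv : v ∈ K ∧ v ≠ r) :
      ∃ u, G₁.Adj v u ∧ u ∈ K ∧ G₁.dist u r < G₁.dist v r := by
    obtain ⟨p, hp⟩ := hv.1.exists_walk_length_eq_dist
    cases p with
    | nil => exact absurd rfl hv.2
    | @cons _ u _ h p =>
      refine ⟨u, h, ⟨p⟩, ?_⟩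
      rw [← hp, SimpleGraph.Walk.length_cons]
      exact Nat.lt_succ_of_le (SimpleGraph.dist_le p)
  choose! p₁ hp₁ using hstep
  obtain ⟨walk⟩ := hG r (c 0)
  have hc0K : c 0 ∉ K := fun h => hKP _ h (apply_mem_pathFinset c (by omega))
  obtain ⟨dart, -, hd1, hd2⟩ := walk.exists_boundary_dart K hrK hc0K
  set w := dart.fst with hw
  set q := dart.snd with hq
  have hwq : G.Adj w q := dart.adj
  have hclosed (u v : V) (h : G.Adj u v) (hv : v ∈ K) (hu : u ∉ pathFinset c m) : u ∈ K :=
    (SimpleGraph.Adj.reachable (show G₁.Adj u v from ⟨h, hu, hKP v hv⟩)).trans hv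
  have hqP : q ∈ pathFinset c m := by
    by_contra h
    exact hd2 (hclosed q w hwq.symm hd1 h)
  have hpK (v : V) (hv0 : v ≠ c 0) (hv : v ∉ K) : p v ∉ K := by
    intro h
    by_cases hvm : v ∈ pathFinset c m
    · obtain ⟨i, hi, rfl⟩ := mem_pathFinset.1 hvm
      rcases i with _ | i
      · exact hv0 rfl
      · rw [hp i (by omega)] at h
        exact hKP _ h (apply_mem_pathFinset c (by omega))
    · exact hv (hclosed v (p v) (hp' v hv0).1 h hvm)
  refine ⟨fun v => if v ∈ K then p₁ v else p v, w, q, fun i hi => ?_, fun v hv0 hvr => ?_,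
    hKP w hd1, hqP, hwq, injOn_sym2_of_rank
      (h := fun v => if v ∈ K then G₁.dist v r else G.dist (c 0) v) fun v hv => ?_,
    fun v hv0 hvr h => ?_⟩
  · have : c (i + 1) ∉ K := fun h => hKP _ h (apply_mem_pathFinset c (by omega))
    simp only [this, if_false, hp i hi]
  · by_cases hv : v ∈ K
    · simp only [hv, if_true]
      exact (hp₁ v ⟨hv, hvr⟩).1.1
    · simp only [hv, if_false]
      exact (hp' v hv0).1
  · obtain ⟨hv0, hvr⟩ := hv
    by_cases hv : v ∈ K
    · have := hp₁ v ⟨hv, hvr⟩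
      simp only [hv, if_true, this.2.1]
      exact this.2.2
    · simp only [hv, if_false, hpK v hv0 hv]
      exact (hp' v hv0).2
  · rcases Sym2.eq_iff.1 h with ⟨h1, h2⟩ | ⟨h1, h2⟩
    · rw [← h1] at hd1
      simp only [hd1, if_true] at h2
      exact hd2 (h2 ▸ (hp₁ v ⟨hd1, hvr⟩).2.1)
    · rw [← h1] at hd2
      simp only [hd2, if_false] at h2
      exact hpK v hv0 hd2 (h2 ▸ hd1)

end Geodesic

/-! ### Comparing a unicyclic graph with a spiral -/

section Comparison

open Finset

variable {V : Type*} {α : ℝ} {x : V → ℝ} {m : ℕ}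

theorem sum_skip_mono (h0 : 0 ≤ α) (h1 : α < 1) (hx : ∀ v, 0 < x v) {t t' : ℕ → V}
    (h : ∀ i ≤ m + 1, x (t i) ≤ x (t' i)) :
    ∑ i ∈ range m, edgeWeight α (x (t i)) (x (t (i + 2))) ≤
      ∑ i ∈ range m, edgeWeight α (x (t' i)) (x (t' (i + 2))) :=
  Finset.sum_le_sum fun i hi => by
    rw [Finset.mem_range] at hi
    exact edgeWeight_mono h0 h1 (hx _).le (hx _).le (h _ (by omega)) (h _ (by omega))

/-- Replacing the first two terms of a sequence of vertices. -/
def replaceTwo (t : ℕ → V) (r z : V) : ℕ → V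
  | 0 => r
  | 1 => z
  | i + 2 => t (i + 2)

theorem replaceTwo_injOn {t : ℕ → V} (ht : Set.InjOn t (Set.Iic (m + 1))) {r z : V} (hrz : r ≠ z)
    (hr : ∀ i < m, t (i + 2) ≠ r) (hz : ∀ i < m, t (i + 2) ≠ z) :
    Set.InjOn (replaceTwo t r z) (Set.Iic (m + 1)) := by
  intro i hi j hj hij
  rw [Set.mem_Iic] at hi hj
  rcases i with _ | _ | i <;> rcases j with _ | _ | j <;> simp only [replaceTwo] at hij
  · rfl
  · exact absurd hij hrz
  · exact absurd hij.symm (hr j (by omega))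
  · exact absurd hij.symm hrz
  · rfl
  · exact absurd hij.symm (hz j (by omega))
  · exact absurd hij (hr i (by omega))
  · exact absurd hij (hz i (by omega))
  · exact ht (Set.mem_Iic.2 hi) (Set.mem_Iic.2 hj) hij

theorem notMem_pathFinset_replaceTwo [DecidableEq V] {t : ℕ → V} {r z w : V} (hr : w ≠ r)
    (hz : w ≠ z) (ht : ∀ i < m, t (i + 2) ≠ w) : w ∉ pathFinset (replaceTwo t r z) m := by
  intro h
  obtain ⟨i, hi, h⟩ := mem_pathFinset.1 h
  rcases i with _ | _ | i <;> simp only [replaceTwo] at h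
  · exact hr h.symm
  · exact hz h.symm
  · exact ht i (by omega) h

/-- Raising the parents of all vertices of `S` to a vertex `r` of maximal value does not
decrease the weight, and an edge `s(y, r)` can be exchanged with the edge from `y` to its
parent. -/
theorem sum_parents_exchange (h0 : 0 ≤ α) (h1 : α < 1) (hx : ∀ v, 0 < x v) {r : V}
    (hr : ∀ v, x v ≤ x r) (p : V → V) (S : Finset V) :
    ∑ u ∈ S, edgeWeight α (x u) (x (p u)) ≤ ∑ u ∈ S, edgeWeight α (x u) (x r) ∧
      ∀ y ∈ S, ∑ u ∈ S, edgeWeight α (x u) (x (p u)) + edgeWeight α (x y) (x r) ≤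
        ∑ u ∈ S, edgeWeight α (x u) (x r) + edgeWeight α (x y) (x (p y)) := by
  have h (u : V) : edgeWeight α (x u) (x (p u)) ≤ edgeWeight α (x u) (x r) :=
    edgeWeight_mono h0 h1 (hx _).le (hx _).le le_rfl (hr _)
  classical
  refine ⟨Finset.sum_le_sum fun u _ => h u, fun y hy => ?_⟩
  rw [← Finset.sum_erase_add S _ hy, ← Finset.sum_erase_add S _ hy]
  have := Finset.sum_le_sum fun u (_ : u ∈ S.erase y) => h u
  linarith

/-- The extra edge can be assumed to start off the path. -/
theorem exists_notMem_of_extra_edge [DecidableEq V] {G : SimpleGraph V} (hG : G.Connected)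
    {c : ℕ → V} (hc : IsGeodesic m G c) {e : Sym2 V} (he : e ∈ G.edgeSet)
    (hce : ∀ i ≤ m, s(c (i + 1), c i) ≠ e) :
    ∃ y v, y ∉ pathFinset c m ∧ G.Adj y v ∧ e = s(y, v) := by
  induction e with | _ y v =>
  rw [SimpleGraph.mem_edgeSet] at he
  by_cases hy : y ∈ pathFinset c m
  · by_cases hv : v ∈ pathFinset c m
    · exfalso
      obtain ⟨i, hi, rfl⟩ := mem_pathFinset.1 hy
      obtain ⟨j, hj, rfl⟩ := mem_pathFinset.1 hv
      rcases (hc.adj_iff hG hi hj).1 he with rfl | rfl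
      · exact hce i (by omega) Sym2.eq_swap
      · exact hce j (by omega) rfl
    · exact ⟨v, y, hv, he.symm, Sym2.eq_swap⟩
  · exact ⟨y, v, hy, he, rfl⟩

/-- The vertices of a path, sorted by decreasing value. -/
theorem exists_sorted [DecidableEq V] {c : ℕ → V} (hc : Set.InjOn c (Set.Iic (m + 1))) (x : V → ℝ) :
    ∃ t : ℕ → V, Set.InjOn t (Set.Iic (m + 1)) ∧ pathFinset t m = pathFinset c m ∧
      (∀ i j, i ≤ j → j ≤ m + 1 → x (t j) ≤ x (t i)) ∧
      ((List.range (m + 2)).map fun i => x (c i)).Perm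
        ((List.range (m + 2)).map fun i => x (t i)) := by
  set f : Fin (m + 2) → ℝ := fun i => -x (c i) with hf
  set σ := Tuple.sort f with hσ
  have hmono : Monotone (f ∘ σ) := Tuple.monotone_sort f
  set t : ℕ → V := fun i => if h : i < m + 2 then c (σ ⟨i, h⟩) else c 0 with ht
  have hti (i : Fin (m + 2)) : t i = c (σ i) := by simp [ht]
  have hti' {i : ℕ} (h : i ≤ m + 1) : t i = c (σ ⟨i, by omega⟩) := hti ⟨i, by omega⟩
  refine ⟨t, fun i hi j hj hij => ?_, ?_, fun i j hij hj => ?_, ?_⟩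
  · rw [Set.mem_Iic] at hi hj
    rw [hti' hi, hti' hj] at hij
    have := hc (Set.mem_Iic.2 (Nat.lt_succ_iff.1 (σ _).isLt))
      (Set.mem_Iic.2 (Nat.lt_succ_iff.1 (σ _).isLt)) hij
    have := σ.injective (Fin.ext this)
    simpa using this
  · ext u
    rw [mem_pathFinset, mem_pathFinset]
    constructor
    · rintro ⟨i, hi, rfl⟩
      exact ⟨σ ⟨i, by omega⟩, Nat.lt_succ_iff.1 (σ _).isLt, (hti' hi).symm⟩
    · rintro ⟨i, hi, rfl⟩
      refine ⟨σ.symm ⟨i, by omega⟩, Nat.lt_succ_iff.1 (σ.symm _).isLt, ?_⟩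
      rw [hti]; simp
  · have := hmono (show (⟨i, by omega⟩ : Fin (m + 2)) ≤ ⟨j, by omega⟩ from hij)
    simp only [Function.comp_apply, hf] at this
    rw [hti' (show i ≤ m + 1 by omega), hti' hj]
    linarith
  · have e1 (g : ℕ → ℝ) : (List.range (m + 2)).map g = List.ofFn fun i : Fin (m + 2) => g i :=
      List.ext_getElem (by simp) fun i _ _ => by
        rw [List.getElem_map, List.getElem_range, List.getElem_ofFn]
    rw [e1, e1]
    simp only [hti]
    exact (Equiv.Perm.ofFn_comp_perm σ fun i => x (c i)).symm

variable [Fintype V] [DecidableEq V]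

/-- The weight of a spiral with the given parameters, for the vertex values `x`. -/
def spiralWeight (α : ℝ) (x : V → ℝ) (m : ℕ) (t : ℕ → V) (w : V) : ℝ :=
  edgeWeight α (x w) (x (t 1)) + (edgeWeight α (x (t 0)) (x (t 1)) +
    ∑ i ∈ range m, edgeWeight α (x (t i)) (x (t (i + 2))) +
      ∑ u ∈ (pathFinset t m)ᶜ, edgeWeight α (x u) (x (t 0)))

open Classical in
theorem IsSpiral.sum_pairWeight {H : SimpleGraph V} {t : ℕ → V} {w : V}
    (hS : IsSpiral m H t w) :
    ∑ e ∈ H.edgeFinset, pairWeight α x e = spiralWeight α x m t w := by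
  rw [hS.edges.2]; rfl

theorem sum_compl_pathFinset {t : ℕ → V} (ht : Set.InjOn t (Set.Iic (m + 1))) (φ : V → ℝ) :
    ∑ u ∈ (pathFinset t m)ᶜ, φ u =
      ∑ u, φ u - φ (t 0) - φ (t 1) - ∑ i ∈ range m, φ (t (i + 2)) := by
  have h1 := sum_erase_eq_sum_path_add ht φ
  have h2 := Finset.sum_erase_add univ φ (mem_univ (t 0))
  rw [Finset.sum_range_succ'] at h1
  simp only [zero_add, add_assoc, Nat.reduceAdd] at h1
  linarith

open Classical in
/-- The edges of `G` consist of the path, one edge for each vertex off the path, and one more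
edge. Raising the value at the upper end of the edges of the second kind to the maximum bounds
their weights; an extra edge ending at the vertex `r` of maximal value is exchanged with the edge
of its other end. -/
theorem sum_pairWeight_le_of_mem (h0 : 0 ≤ α) (h1 : α < 1) (hx : ∀ v, 0 < x v) {G : SimpleGraph V}
    (hG : G.Connected) (hcard : G.edgeSet.ncard = Fintype.card V) {c : ℕ → V}
    (hc : IsGeodesic m G c) {r : V} (hr : ∀ v, x v ≤ x r) (hrc : r ∈ pathFinset c m) :
    ∃ y v, y ∉ pathFinset c m ∧ v ≠ r ∧ G.Adj y v ∧ ∑ e ∈ G.edgeFinset, pairWeight α x e ≤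
      ∑ i ∈ range (m + 1), edgeWeight α (x (c i)) (x (c (i + 1))) +
        ∑ u ∈ (pathFinset c m)ᶜ, edgeWeight α (x u) (x r) + edgeWeight α (x y) (x v) := by
  obtain ⟨p, hp, hp'⟩ := exists_parents hc hG
  obtain ⟨e, he, hne, -, hsum⟩ := exists_extra_edge hcard (r := c 0) (g := fun v => s(v, p v))
    (injOn_sym2_of_rank (h := G.dist (c 0)) fun v hv => (hp' v hv).2) fun v hv => (hp' v hv).1
  have hc0 (i : ℕ) (hi : i ≤ m) : c (i + 1) ≠ c 0 := fun h =>
    absurd (hc.injOn hG (Set.mem_Iic.2 (by omega)) (Set.mem_Iic.2 (by omega)) h) (by omega)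
  obtain ⟨y, v, hy, hyv, rfl⟩ := exists_notMem_of_extra_edge hG hc he fun i hi h =>
    hne (c (i + 1)) (hc0 i hi) (by rw [hp i hi, h])
  rw [hsum, sum_erase_eq_sum_path_add (hc.injOn hG) fun v => pairWeight α x s(v, p v)]
  have hpath : ∑ i ∈ range (m + 1), pairWeight α x s(c (i + 1), p (c (i + 1))) =
      ∑ i ∈ range (m + 1), edgeWeight α (x (c i)) (x (c (i + 1))) :=
    Finset.sum_congr rfl fun i hi => by
      rw [hp i (by rw [Finset.mem_range] at hi; omega), pairWeight_mk, edgeWeight_comm]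
  rw [hpath]
  simp only [pairWeight_mk]
  obtain ⟨hex1, hex2⟩ := sum_parents_exchange h0 h1 hx hr p (pathFinset c m)ᶜ
  have hyc : y ≠ c 0 := fun h => hy (h ▸ apply_mem_pathFinset c (by omega))
  by_cases hvr : v = r
  · subst hvr
    refine ⟨y, p y, hy, fun h => hne y hyc (by rw [h]), (hp' y hyc).1, ?_⟩
    have := hex2 y (Finset.mem_compl.2 hy)
    linarith
  · exact ⟨y, v, hy, hvr, hyv, by linarith⟩

open Classical in
/-- The same decomposition when the vertex `r` of maximal value lies off the path. Here one edge
joining the component of `r` to the path comes in addition. In the last alternative `r` has two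
neighbours on the path. -/
theorem sum_pairWeight_le_of_notMem (h0 : 0 ≤ α) (h1 : α < 1) (hx : ∀ v, 0 < x v)
    {G : SimpleGraph V} (hG : G.Connected) (hcard : G.edgeSet.ncard = Fintype.card V) {c : ℕ → V}
    (hc : IsGeodesic m G c) {r z : V} (hr : ∀ v, x v ≤ x r) (hrc : r ∉ pathFinset c m)
    (hz : ∀ v ∈ pathFinset c m, x v ≤ x z) :
    (∃ y v, y ∉ pathFinset c m ∧ y ≠ r ∧ v ≠ r ∧ y ≠ v ∧
      ∑ e ∈ G.edgeFinset, pairWeight α x e ≤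
        ∑ i ∈ range (m + 1), edgeWeight α (x (c i)) (x (c (i + 1))) +
          ∑ u ∈ (pathFinset c m)ᶜ.erase r, edgeWeight α (x u) (x r) +
          edgeWeight α (x z) (x r) + edgeWeight α (x y) (x v)) ∨
    (∃ q ∈ pathFinset c m, ∃ v ∈ pathFinset c m, q ≠ v ∧
      ∑ e ∈ G.edgeFinset, pairWeight α x e ≤
        ∑ i ∈ range (m + 1), edgeWeight α (x (c i)) (x (c (i + 1))) +
          ∑ u ∈ (pathFinset c m)ᶜ.erase r, edgeWeight α (x u) (x r) +
          edgeWeight α (x q) (x r) + edgeWeight α (x v) (x r)) := by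
  obtain ⟨p, w, q, hp, hadj, hw, hq, hwq, hinj, hnwq⟩ := exists_parents_of_notMem hc hG hrc
  have hc0 (i : ℕ) (hi : i ≤ m) : c (i + 1) ≠ c 0 := fun h =>
    absurd (hc.injOn hG (Set.mem_Iic.2 (by omega)) (Set.mem_Iic.2 (by omega)) h) (by omega)
  have hcr (i : ℕ) (hi : i ≤ m) : c (i + 1) ≠ r := fun h =>
    hrc (h ▸ apply_mem_pathFinset c (by omega))
  have hr0 : r ≠ c 0 := fun h => hrc (h ▸ apply_mem_pathFinset c (by omega))
  set g : V → Sym2 V := fun v => if v = r then s(w, q) else s(v, p v) with hg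
  have hgr : g r = s(w, q) := if_pos rfl
  have hgv (v : V) (hv : v ≠ r) : g v = s(v, p v) := if_neg hv
  have hginj : Set.InjOn g {c 0}ᶜ := by
    intro a ha b hb hab
    by_cases har : a = r <;> by_cases hbr : b = r
    · rw [har, hbr]
    · rw [har, hgr, hgv b hbr] at hab
      exact absurd hab.symm (hnwq b hb hbr)
    · rw [hbr, hgr, hgv a har] at hab
      exact absurd hab (hnwq a ha har)
    · rw [hgv a har, hgv b hbr] at hab
      exact hinj ⟨ha, har⟩ ⟨hb, hbr⟩ hab
  obtain ⟨e, he, hne, -, hsum⟩ := exists_extra_edge hcard (r := c 0) hginj fun v hv => by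
    by_cases hvr : v = r
    · rw [hvr, hgr]; exact hwq
    · rw [hgv v hvr]; exact hadj v hv hvr
  obtain ⟨y, v, hy, hyv, rfl⟩ := exists_notMem_of_extra_edge hG hc he fun i hi h =>
    hne (c (i + 1)) (hc0 i hi) (by rw [hgv _ (hcr i hi), hp i hi, h])
  rw [hsum, sum_erase_eq_sum_path_add (hc.injOn hG) fun v => pairWeight α x (g v)]
  have hpath : ∑ i ∈ range (m + 1), pairWeight α x (g (c (i + 1))) =
      ∑ i ∈ range (m + 1), edgeWeight α (x (c i)) (x (c (i + 1))) :=
    Finset.sum_congr rfl fun i hi => by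
      have hi' : i ≤ m := by rw [Finset.mem_range] at hi; omega
      rw [hgv _ (hcr i hi'), hp i hi', pairWeight_mk, edgeWeight_comm]
  have hoff : ∑ u ∈ (pathFinset c m)ᶜ, pairWeight α x (g u) =
      ∑ u ∈ (pathFinset c m)ᶜ.erase r, edgeWeight α (x u) (x (p u)) +
        edgeWeight α (x w) (x q) := by
    rw [← Finset.sum_erase_add _ _ (Finset.mem_compl.2 hrc), hgr, pairWeight_mk]
    congr 1
    exact Finset.sum_congr rfl fun u hu => by
      rw [hgv u (Finset.ne_of_mem_erase hu), pairWeight_mk]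
  rw [hpath, hoff, pairWeight_mk]
  obtain ⟨hex1, hex2⟩ := sum_parents_exchange h0 h1 hx hr p ((pathFinset c m)ᶜ.erase r)
  have hwq' : edgeWeight α (x w) (x q) ≤ edgeWeight α (x z) (x r) := by
    rw [edgeWeight_comm]
    exact edgeWeight_mono h0 h1 (hx _).le (hx _).le (hz q hq) (hr w)
  have hcomm := edgeWeight_comm α
  -- an extra edge between `r` and another vertex off the path
  have hcase1 (y : V) (hy : y ∉ pathFinset c m) (hyr : y ≠ r) (hey : s(y, v) = s(y, r) ∨
      s(r, y) = s(y, r)) (hne : ∀ v, v ≠ c 0 → g v ≠ s(y, r)) : y ≠ p y ∧ p y ≠ r ∧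
      ∑ u ∈ (pathFinset c m)ᶜ.erase r, edgeWeight α (x u) (x (p u)) + edgeWeight α (x y) (x r) ≤
        ∑ u ∈ (pathFinset c m)ᶜ.erase r, edgeWeight α (x u) (x r) +
          edgeWeight α (x y) (x (p y)) := by
    have hy0 : y ≠ c 0 := fun h => hy (h ▸ apply_mem_pathFinset c (by omega))
    refine ⟨(hadj y hy0 hyr).ne, fun h => hne y hy0 (by rw [hgv y hyr, h]), hex2 y ?_⟩
    exact Finset.mem_erase.2 ⟨hyr, Finset.mem_compl.2 hy⟩
  by_cases hvr : v = r
  · subst hvr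
    have hyr : y ≠ v := hyv.ne
    obtain ⟨a1, a2, a3⟩ := hcase1 y hy hyr (Or.inl rfl) hne
    exact Or.inl ⟨y, p y, hy, hyr, a2, a1, by linarith⟩
  by_cases hyr : y = r
  · subst hyr
    by_cases hvP : v ∈ pathFinset c m
    · by_cases hwr : w = y
      · subst hwr
        refine Or.inr ⟨q, hq, v, hvP, fun h => hne w hr0 (by rw [hgr, h]), ?_⟩
        have a1 := hcomm (x w) (x v)
        have a2 := hcomm (x w) (x q)
        linarith
      · have a1 : edgeWeight α (x y) (x v) ≤ edgeWeight α (x z) (x y) := by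
          rw [hcomm]
          exact edgeWeight_mono h0 h1 (hx _).le (hx _).le (hz v hvP) le_rfl
        exact Or.inl ⟨w, q, hw, hwr, fun h => hrc (h ▸ hq), hwq.ne, by linarith⟩
    · obtain ⟨a1, a2, a3⟩ := hcase1 v hvP hvr (Or.inr Sym2.eq_swap)
        (fun u hu h => hne u hu (h.trans Sym2.eq_swap))
      have a4 := hcomm (x y) (x v)
      exact Or.inl ⟨v, p v, hvP, hvr, a2, a1, by linarith⟩
  · exact Or.inl ⟨y, v, hy, hyr, hvr, hyv.ne, by linarith⟩

/-- In the weight of a spiral whose first two terms are `r` and `z`, the edge `s(r, z)` has the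
weight that `z` would contribute as a pendant vertex at `r`. -/
theorem spiralWeight_replaceTwo {t : ℕ → V} {r z w : V}
    (ht : Set.InjOn (replaceTwo t r z) (Set.Iic (m + 1))) :
    spiralWeight α x m (replaceTwo t r z) w = edgeWeight α (x w) (x z) +
      ∑ i ∈ range m, edgeWeight α (x (replaceTwo t r z i)) (x (replaceTwo t r z (i + 2))) +
      (∑ u, edgeWeight α (x u) (x r) - edgeWeight α (x r) (x r) -
        ∑ i ∈ range m, edgeWeight α (x (t (i + 2))) (x r)) := by
  rw [spiralWeight, sum_compl_pathFinset ht]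
  have := edgeWeight_comm α (x r) (x z)
  simp only [replaceTwo] at this ⊢
  linarith

open Classical in
/-- The Perron vector of `G` can be rearranged on a spiral without decreasing the quadratic form.
The last alternative records what is needed to identify `G` in case of equality: then the spiral
uses the path of `G`, sorted by decreasing value. -/
theorem exists_le_spiralWeight (hm : 1 ≤ m) (h0 : 0 ≤ α) (h1 : α < 1) (hx : ∀ v, 0 < x v)
    {G : SimpleGraph V} (hG : G.Connected) (hcard : G.edgeSet.ncard = Fintype.card V) {c : ℕ → V}
    (hc : IsGeodesic m G c) : ∃ (t : ℕ → V) (w : V), Set.InjOn t (Set.Iic (m + 1)) ∧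
      w ∉ pathFinset t m ∧ (∑ e ∈ G.edgeFinset, pairWeight α x e < spiralWeight α x m t w ∨
        ∑ e ∈ G.edgeFinset, pairWeight α x e ≤ spiralWeight α x m t w ∧ (x (t 1) ≤ x w ∨
          pathFinset t m = pathFinset c m ∧
          (∀ i j, i ≤ j → j ≤ m + 1 → x (t j) ≤ x (t i)) ∧
          ∃ j ≤ m + 1, c j ≠ t 0 ∧ G.Adj w (c j) ∧
            (∑ e ∈ G.edgeFinset, pairWeight α x e = spiralWeight α x m t w →
              x (c j) = x (t 1)))) := by
  obtain ⟨t, htinj, htP, hanti, hperm⟩ := exists_sorted (hc.injOn hG) x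
  have hpath := sum_edgeWeight_path_le h0 h1 m (fun i => x (c i)) (fun i => x (t i))
    (fun i _ => (hx _).le) hanti hperm
  have htmem (i : ℕ) (hi : i ≤ m + 1) : t i ∈ pathFinset c m := htP ▸ apply_mem_pathFinset t hi
  have hne (i j : ℕ) (hi : i ≤ m + 1) (hj : j ≤ m + 1) (hij : i ≠ j) : t i ≠ t j := fun h =>
    hij (htinj (Set.mem_Iic.2 hi) (Set.mem_Iic.2 hj) h)
  have htmax (v : V) (hv : v ∈ pathFinset c m) : x v ≤ x (t 0) := by
    rw [← htP] at hv
    obtain ⟨i, hi, rfl⟩ := mem_pathFinset.1 hv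
    exact hanti 0 i (Nat.zero_le _) hi
  have hmono {a a' b b' : V} (ha : x a ≤ x a') (hb : x b ≤ x b') :
      edgeWeight α (x a) (x b) ≤ edgeWeight α (x a') (x b') :=
    edgeWeight_mono h0 h1 (hx _).le (hx _).le ha hb
  have := hG.nonempty
  obtain ⟨r, hr⟩ := Finite.exists_max x
  by_cases hmax : ∀ v, x v ≤ x (t 0)
  · -- the maximum is attained on the path
    obtain ⟨y, v, hy, hv0, hyv, hle⟩ := sum_pairWeight_le_of_mem h0 h1 hx hG hcard hc hmax
      (htmem 0 (by omega))
    by_cases hvP : v ∈ pathFinset c m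
    · have hv1 : x v ≤ x (t 1) := by
        rw [← htP] at hvP
        obtain ⟨i, hi, rfl⟩ := mem_pathFinset.1 hvP
        exact hanti 1 i (Nat.one_le_iff_ne_zero.2 fun h => hv0 (h ▸ rfl)) hi
      have hbound : ∑ e ∈ G.edgeFinset, pairWeight α x e + edgeWeight α (x y) (x (t 1)) ≤
          spiralWeight α x m t y + edgeWeight α (x y) (x v) := by
        rw [spiralWeight, htP]; linarith
      have hyt := hmono (le_refl (x y)) hv1
      refine ⟨t, y, htinj, htP ▸ hy, Or.inr ⟨by linarith, Or.inr ⟨htP, hanti, ?_⟩⟩⟩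
      obtain ⟨j, hj, rfl⟩ := mem_pathFinset.1 hvP
      refine ⟨j, hj, hv0, hyv, fun heq => hv1.antisymm (le_of_not_gt fun hlt => ?_)⟩
      have := edgeWeight_strictMono_left h0 h1 (hx _).le (hx y) hlt
      rw [edgeWeight_comm, edgeWeight_comm α (x (t 1))] at this
      linarith
    · -- both ends of the extra edge are off the path
      obtain ⟨y, v, hy, hvP, hyv, hxv, hle⟩ : ∃ y v, y ∉ pathFinset c m ∧ v ∉ pathFinset c m ∧
          y ≠ v ∧ x v ≤ x y ∧ ∑ e ∈ G.edgeFinset, pairWeight α x e ≤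
          ∑ i ∈ range (m + 1), edgeWeight α (x (c i)) (x (c (i + 1))) +
            ∑ u ∈ (pathFinset c m)ᶜ, edgeWeight α (x u) (x (t 0)) +
            edgeWeight α (x y) (x v) := by
        rcases le_total (x v) (x y) with h | h
        · exact ⟨y, v, hy, hvP, hyv.ne, h, hle⟩
        · exact ⟨v, y, hvP, hy, hyv.ne', h, by rwa [edgeWeight_comm α (x v)]⟩
      rcases le_or_gt (x v) (x (t 1)) with hv1 | hv1
      · have hbound : ∑ e ∈ G.edgeFinset, pairWeight α x e + edgeWeight α (x y) (x (t 1)) ≤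
            spiralWeight α x m t y + edgeWeight α (x y) (x v) := by
          rw [spiralWeight, htP]; linarith
        refine ⟨t, y, htinj, htP ▸ hy, ?_⟩
        rcases le_or_gt (x (t 1)) (x y) with hy1 | hy1
        · have := hmono (le_refl (x y)) hv1
          exact Or.inr ⟨by linarith, Or.inl hy1⟩
        · have := edgeWeight_strictMono_left h0 h1 (hx _).le (hx y) (hxv.trans_lt hy1)
          rw [edgeWeight_comm, edgeWeight_comm α (x (t 1))] at this
          exact Or.inl (by linarith)
      · -- `v` takes the place of `t 1`
        have hinj : Set.InjOn (replaceTwo t (t 0) v) (Set.Iic (m + 1)) :=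
          replaceTwo_injOn htinj (fun h => hvP (h ▸ htmem 0 (by omega)))
            (fun i hi => hne _ _ (by omega) (by omega) (by omega))
            (fun i hi h => hvP (h ▸ htmem _ (by omega)))
        refine ⟨replaceTwo t (t 0) v, y, hinj, notMem_pathFinset_replaceTwo
          (fun h => hy (h ▸ htmem 0 (by omega))) hyv (fun i hi h => hy (h ▸ htmem _ (by omega))),
          Or.inr ⟨?_, Or.inl hxv⟩⟩
        rw [spiralWeight_replaceTwo hinj]
        have hskip := sum_skip_mono (m := m) h0 h1 hx (t := t) (t' := replaceTwo t (t 0) v)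
          fun i hi => by
            rcases i with _ | _ | i
            · exact le_rfl
            · exact hv1.le
            · exact le_rfl
        rw [← htP, sum_compl_pathFinset htinj] at hle
        have := edgeWeight_comm α (x (t 0)) (x (t 1))
        linarith
  · -- the maximum is attained only off the path
    push Not at hmax
    obtain ⟨v₀, hv₀⟩ := hmax
    have hrt : x (t 0) < x r := hv₀.trans_le (hr v₀)
    have hrP : r ∉ pathFinset c m := fun h => absurd (htmax r h) (not_le.2 hrt)
    have hskip (z : V) (hz : x (t 1) ≤ x z) :
        ∑ i ∈ range m, edgeWeight α (x (t i)) (x (t (i + 2))) <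
          ∑ i ∈ range m, edgeWeight α (x (replaceTwo t r z i)) (x (replaceTwo t r z (i + 2))) := by
      have hle (i : ℕ) : x (t i) ≤ x (replaceTwo t r z i) := by
        rcases i with _ | _ | i
        · exact hrt.le
        · exact hz
        · exact le_rfl
      refine Finset.sum_lt_sum (fun i _ => hmono (hle i) (hle _)) ⟨0, Finset.mem_range.2 hm, ?_⟩
      exact edgeWeight_strictMono_left h0 h1 (hx _).le (hx _) hrt
    have hinj (z : V) (hrz : r ≠ z) (hz : ∀ i < m, t (i + 2) ≠ z) :
        Set.InjOn (replaceTwo t r z) (Set.Iic (m + 1)) :=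
      replaceTwo_injOn htinj hrz (fun i hi h => hrP (h ▸ htmem _ (by omega))) hz
    have hoff : ∑ u ∈ (pathFinset c m)ᶜ.erase r, edgeWeight α (x u) (x r) =
        ∑ u, edgeWeight α (x u) (x r) - edgeWeight α (x (t 0)) (x r) -
          edgeWeight α (x (t 1)) (x r) - ∑ i ∈ range m, edgeWeight α (x (t (i + 2))) (x r) -
          edgeWeight α (x r) (x r) := by
      rw [← sum_compl_pathFinset htinj fun u => edgeWeight α (x u) (x r), htP]
      have := Finset.sum_erase_add _ (fun u => edgeWeight α (x u) (x r)) (Finset.mem_compl.2 hrP)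
      linarith
    have ht1r : edgeWeight α (x (t 0)) (x (t 1)) ≤ edgeWeight α (x (t 1)) (x r) := by
      rw [edgeWeight_comm]; exact hmono le_rfl hrt.le
    rcases sum_pairWeight_le_of_notMem h0 h1 hx hG hcard hc hr hrP htmax with
      ⟨y, v, hy, hyr, hvr, hyv, hle⟩ | ⟨q, hq, v, hv, hqv, hle⟩
    · obtain ⟨z, hrz, hzt, hyz, hz1, hvz⟩ : ∃ z, r ≠ z ∧ (∀ i < m, t (i + 2) ≠ z) ∧ y ≠ z ∧
          x (t 1) ≤ x z ∧ x v ≤ x z := by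
        by_cases hv0 : x v ≤ x (t 0)
        · exact ⟨t 0, fun h => hrP (h ▸ htmem 0 (by omega)),
            fun i hi => hne _ _ (by omega) (by omega) (by omega),
            fun h => hy (h ▸ htmem 0 (by omega)), hanti 0 1 (by omega) (by omega), hv0⟩
        · have hvP : v ∉ pathFinset c m := fun h => hv0 (htmax v h)
          exact ⟨v, hvr.symm, fun i hi h => hvP (h ▸ htmem _ (by omega)), hyv,
            (hanti 0 1 (by omega) (by omega)).trans (not_le.1 hv0).le, le_rfl⟩
      refine ⟨replaceTwo t r z, y, hinj z hrz hzt, notMem_pathFinset_replaceTwo hyr hyz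
        (fun i hi h => hy (h ▸ htmem _ (by omega))), Or.inl ?_⟩
      rw [spiralWeight_replaceTwo (hinj z hrz hzt)]
      have a1 := hskip z hz1
      have a2 := hmono (le_refl (x y)) hvz
      linarith
    · have hr0 : r ≠ t 0 := fun h => hrP (h ▸ htmem 0 (by omega))
      have hinj0 := hinj (t 0) hr0 fun i hi => hne _ _ (by omega) (by omega) (by omega)
      refine ⟨replaceTwo t r (t 0), t 1, hinj0, notMem_pathFinset_replaceTwo
        (fun h => hrP (h ▸ htmem 1 (by omega))) (hne _ _ (by omega) (by omega) (by omega))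
        (fun i hi => hne _ _ (by omega) (by omega) (by omega)), Or.inl ?_⟩
      rw [spiralWeight_replaceTwo hinj0]
      have a1 := hskip (t 0) (hanti 0 1 (by omega) (by omega))
      have a2 := edgeWeight_comm α (x (t 0)) (x (t 1))
      -- two distinct vertices of the path have values at most those of `t 0` and `t 1`
      have a3 : edgeWeight α (x q) (x r) + edgeWeight α (x v) (x r) ≤
          edgeWeight α (x (t 0)) (x r) + edgeWeight α (x (t 1)) (x r) := by
        have a4 := hmono (htmax q hq) (le_refl (x r))
        have a5 := hmono (htmax v hv) (le_refl (x r))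
        rw [← htP] at hq hv
        obtain ⟨i, hi, rfl⟩ := mem_pathFinset.1 hq
        obtain ⟨j, hj, rfl⟩ := mem_pathFinset.1 hv
        rcases Nat.eq_zero_or_pos i with rfl | hi0
        · have hj0 : 1 ≤ j := Nat.one_le_iff_ne_zero.2 fun h => hqv (h ▸ rfl)
          have := hmono (hanti 1 j hj0 hj) (le_refl (x r))
          linarith
        · have := hmono (hanti 1 i hi0 hi) (le_refl (x r))
          linarith
      linarith

end Comparison

/-! ### The case of equality -/

section Equality

open Finset

variable {V : Type*} [Fintype V] [DecidableEq V] {α ρ : ℝ} {x : V → ℝ} {m : ℕ}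

open Classical in
theorem eigenvector_apply {G : SimpleGraph V} (hGx : Matrix.mulVec (alphaMatrix α G) x = ρ • x)
    (v : V) : ρ * x v = ∑ u with G.Adj v u, (α * x v + (1 - α) * x u) := by
  rw [← alphaMatrix_mulVec_apply, hGx]; rfl

open Classical in
theorem eigenvector_apply_of_adj_iff {G : SimpleGraph V}
    (hGx : Matrix.mulVec (alphaMatrix α G) x = ρ • x) {v : V} {S : Finset V}
    (hS : ∀ u, G.Adj v u ↔ u ∈ S) : ρ * x v = ∑ u ∈ S, (α * x v + (1 - α) * x u) := by
  rw [eigenvector_apply hGx]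
  congr 1
  ext u; simp [hS]

/-- If the sums of positive numbers over `S ⊆ T` agree then `T ⊆ S`. -/
theorem mem_of_sum_le_of_subset {ι : Type*} {S T : Finset ι} (hST : S ⊆ T) {h : ι → ℝ}
    (hpos : ∀ u, 0 < h u)
    (hle : ∑ u ∈ T, h u ≤ ∑ u ∈ S, h u) {u : ι} (hu : u ∈ T) : u ∈ S := by
  by_contra huS
  exact absurd (Finset.sum_lt_sum_of_subset hST hu huS (hpos u) fun v _ _ => (hpos v).le)
    (not_lt.2 hle)

section SpiralNeighbours

variable {H : SimpleGraph V} {t : ℕ → V} {w : V}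

theorem IsSpiral.apply_ne (hS : IsSpiral m H t w) {i j : ℕ} (hi : i ≤ m + 1) (hj : j ≤ m + 1)
    (hij : i ≠ j) : t i ≠ t j := fun h => hij (hS.inj (Set.mem_Iic.2 hi) (Set.mem_Iic.2 hj) h)

theorem IsSpiral.apply_ne_w (hS : IsSpiral m H t w) {i : ℕ} (hi : i ≤ m + 1) : t i ≠ w :=
  fun h => hS.notMem (h ▸ apply_mem_pathFinset t hi)

theorem IsSpiral.adj_zero_iff (hm : 1 ≤ m) (hS : IsSpiral m H t w) (u : V) :
    H.Adj (t 0) u ↔ u ∈ insert (t 1) (insert (t 2) (pathFinset t m)ᶜ) := by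
  rw [mem_insert, mem_insert, mem_compl]
  constructor
  · intro h
    rcases (hS.edges.1 _ _).1 h with h | h
    · rcases h with ⟨-, h⟩ | ⟨i, hi, h, h'⟩ | ⟨h, -⟩ | ⟨h, -⟩
      · exact Or.inl h
      · obtain rfl : 0 = i := by
          by_contra h0; exact hS.apply_ne (by omega) (by omega) h0 h
        exact Or.inr (Or.inl h')
      · exact absurd h (hS.apply_ne_w (by omega))
      · exact absurd (apply_mem_pathFinset t (by omega)) h
    · rcases h with ⟨-, h⟩ | ⟨i, hi, -, h⟩ | ⟨-, h⟩ | ⟨h, -⟩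
      · exact absurd h (hS.apply_ne (by omega) (by omega) (by omega))
      · exact absurd h (hS.apply_ne (by omega) (by omega) (by omega))
      · exact absurd h (hS.apply_ne (by omega) (by omega) (by omega))
      · exact Or.inr (Or.inr h)
  · rintro (rfl | rfl | h)
    · exact hS.adj_zero_one
    · exact hS.adj_skip 0 hm
    · exact (hS.adj_hub u h).symm

theorem IsSpiral.adj_w_iff (hS : IsSpiral m H t w) (u : V) :
    H.Adj w u ↔ u ∈ ({t 0, t 1} : Finset V) := by
  rw [mem_insert, mem_singleton]
  constructor
  · intro h
    rcases (hS.edges.1 _ _).1 h with h | h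
    · rcases h with ⟨h, -⟩ | ⟨i, hi, h, -⟩ | ⟨-, h⟩ | ⟨-, h⟩
      · exact absurd h.symm (hS.apply_ne_w (by omega))
      · exact absurd h.symm (hS.apply_ne_w (by omega))
      · exact Or.inr h
      · exact Or.inl h
    · rcases h with ⟨-, h⟩ | ⟨i, hi, -, h⟩ | ⟨-, h⟩ | ⟨-, h⟩
      · exact absurd h.symm (hS.apply_ne_w (by omega))
      · exact absurd h.symm (hS.apply_ne_w (by omega))
      · exact absurd h.symm (hS.apply_ne_w (by omega))
      · exact absurd h.symm (hS.apply_ne_w (by omega))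
  · rintro (rfl | rfl)
    · exact hS.adj_hub w hS.notMem
    · exact hS.adj_w

theorem IsSpiral.adj_add_two_iff (hS : IsSpiral m H t w) {i : ℕ} (hi : i < m) (u : V) :
    H.Adj (t (i + 2)) u ↔ u = t i ∨ (i + 2 < m ∧ u = t (i + 4)) := by
  constructor
  · intro h
    rcases (hS.edges.1 _ _).1 h with h | h
    · rcases h with ⟨h, -⟩ | ⟨j, hj, h, h'⟩ | ⟨h, -⟩ | ⟨h, -⟩
      · exact absurd h (hS.apply_ne (by omega) (by omega) (by omega))
      · obtain rfl : i + 2 = j := by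
          by_contra h0; exact hS.apply_ne (by omega) (by omega) h0 h
        exact Or.inr ⟨hj, h'⟩
      · exact absurd h (hS.apply_ne_w (by omega))
      · exact absurd (apply_mem_pathFinset t (by omega)) h
    · rcases h with ⟨-, h⟩ | ⟨j, hj, h, h'⟩ | ⟨-, h⟩ | ⟨-, h⟩
      · exact absurd h (hS.apply_ne (by omega) (by omega) (by omega))
      · obtain rfl : i = j := by
          by_contra h0; exact hS.apply_ne (by omega) (by omega) (by omega) h'
        exact Or.inl h
      · exact absurd h (hS.apply_ne (by omega) (by omega) (by omega))
      · exact absurd h (hS.apply_ne (by omega) (by omega) (by omega))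
  · rintro (rfl | ⟨h, rfl⟩)
    · exact (hS.adj_skip i hi).symm
    · exact hS.adj_skip (i + 2) h

open Classical in
/-- In the Perron vector of a spiral of diameter at least three, the vertex `w` of the triangle
has a smaller value than `t 1`, which has a further neighbour. -/
theorem IsSpiral.apply_w_lt (hm : 2 ≤ m) (h0 : 0 ≤ α) (h1 : α < 1) (hx : ∀ v, 0 < x v)
    (hS : IsSpiral m H t w) (hHx : Matrix.mulVec (alphaMatrix α H) x = ρ • x) :
    x w < x (t 1) := by
  have hw := eigenvector_apply_of_adj_iff hHx hS.adj_w_iff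
  have ht01 : t 0 ≠ t 1 := hS.apply_ne (by omega) (by omega) (by omega)
  have ht03 : t 0 ≠ t 3 := hS.apply_ne (by omega) (by omega) (by omega)
  have hw0 : t 0 ≠ w := hS.apply_ne_w (by omega)
  have hw3 : t 3 ≠ w := hS.apply_ne_w (by omega)
  rw [Finset.sum_pair ht01] at hw
  have hsub : ({t 0, w, t 3} : Finset V) ⊆ univ.filter fun u => H.Adj (t 1) u := by
    intro u hu
    rw [mem_insert, mem_insert, mem_singleton] at hu
    rw [mem_filter]
    refine ⟨mem_univ _, ?_⟩
    rcases hu with rfl | rfl | rfl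
    · exact hS.adj_zero_one.symm
    · exact hS.adj_w.symm
    · exact hS.adj_skip 1 (by omega)
  have hpos (v u : V) : 0 < α * x v + (1 - α) * x u := by
    have a1 := mul_nonneg h0 (hx v).le
    have a2 := mul_pos (sub_pos.2 h1) (hx u)
    linarith
  have h3 := Finset.sum_le_sum_of_subset_of_nonneg hsub fun u _ _ => (hpos (t 1) u).le
  rw [← eigenvector_apply hHx, Finset.sum_insert (by simp [hw0, ht03]),
    Finset.sum_pair hw3.symm] at h3
  by_contra hlt
  rw [not_lt] at hlt
  have a1 := hpos (t 1) (t 3)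
  have a2 := mul_pos (sub_pos.2 h1) (hx (t 0))
  have a3 := mul_pos (sub_pos.2 h1) (hx (t 1))
  have a4 : 0 < (ρ - 2 * α) * x w := by linarith
  have a5 : 0 < ρ - 2 * α := pos_of_mul_pos_left a4 (hx w).le
  have a6 := mul_nonneg (by linarith : 0 ≤ ρ - 2 * α + (1 - α)) (sub_nonneg.2 hlt)
  linarith

end SpiralNeighbours

open Classical in
/-- Diameter two: the centre of the spiral is adjacent to all other vertices, hence so it is
in `G`. -/
theorem exists_isSpiral_of_star (h0 : 0 ≤ α) (h1 : α < 1) (hx : ∀ v, 0 < x v)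
    {G H : SimpleGraph V} (hcard : G.edgeSet.ncard = Fintype.card V) (h4 : 4 ≤ Fintype.card V)
    {t : ℕ → V} {w : V} (hS : IsSpiral 1 H t w)
    (hGx : Matrix.mulVec (alphaMatrix α G) x = ρ • x)
    (hHx : Matrix.mulVec (alphaMatrix α H) x = ρ • x) : ∃ t' w', IsSpiral 1 G t' w' := by
  set r := t 0 with hr
  have hHr (u : V) (hu : u ≠ r) : H.Adj r u := by
    rw [hS.adj_zero_iff le_rfl, mem_insert, mem_insert, mem_compl]
    by_cases huP : u ∈ pathFinset t 1
    · obtain ⟨i, hi, rfl⟩ := mem_pathFinset.1 huP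
      have : i = 0 ∨ i = 1 ∨ i = 2 := by omega
      rcases this with rfl | rfl | rfl
      · exact absurd rfl hu
      · exact Or.inl rfl
      · exact Or.inr (Or.inl rfl)
    · exact Or.inr (Or.inr huP)
  have hpos (u : V) : 0 < α * x r + (1 - α) * x u := by
    have a1 := mul_nonneg h0 (hx r).le
    have a2 := mul_pos (sub_pos.2 h1) (hx u)
    linarith
  have hGr (u : V) (hu : u ≠ r) : G.Adj u r := by
    have hsub : (univ.filter fun u => G.Adj r u) ⊆ univ.filter fun u => H.Adj r u := by
      intro v hv
      rw [mem_filter] at hv ⊢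
      exact ⟨mem_univ _, hHr v hv.2.ne'⟩
    have := mem_of_sum_le_of_subset hsub hpos
      (by rw [← eigenvector_apply hHx, ← eigenvector_apply hGx]) (u := u) (by simpa using hHr u hu)
    rw [mem_filter] at this
    exact this.2.symm
  obtain ⟨e, he, hne, -⟩ := exists_extra_edge hcard (r := r) (g := fun v => s(v, r))
    (injOn_sym2_of_rank (p := fun _ => r) (h := fun v => if v = r then 0 else 1) fun v hv => by
      have : v ≠ r := hv
      simp [this]) hGr
  induction e with | _ y z =>
  rw [SimpleGraph.mem_edgeSet] at he
  have hyr : y ≠ r := by rintro rfl; exact hne z he.ne' Sym2.eq_swap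
  have hzr : z ≠ r := by rintro rfl; exact hne y he.ne rfl
  obtain ⟨v, -, hv⟩ := Finset.exists_mem_notMem_of_card_lt_card (s := {r, y, z}) (t := univ)
    (lt_of_le_of_lt Finset.card_le_three (by rw [Finset.card_univ]; omega))
  simp only [mem_insert, mem_singleton, not_or] at hv
  set t' : ℕ → V := fun i => if i = 0 then r else if i = 1 then z else v with ht'
  have e0 : t' 0 = r := rfl
  have e1 : t' 1 = z := rfl
  have e2 : t' 2 = v := rfl
  have hcase {i : ℕ} (hi : i ≤ 1 + 1) : i = 0 ∨ i = 1 ∨ i = 2 := by omega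
  refine ⟨t', y, ⟨fun i hi j hj hij => ?_, fun h => ?_, (hGr z hzr).symm, fun i hi => ?_, he,
    fun u hu => ?_, hcard⟩⟩
  · have b1 : z ≠ v := Ne.symm hv.2.2
    have b2 : r ≠ v := Ne.symm hv.1
    rcases hcase hi with rfl | rfl | rfl <;> rcases hcase hj with rfl | rfl | rfl <;>
      simp_all
  · obtain ⟨i, hi, h⟩ := mem_pathFinset.1 h
    rcases hcase hi with rfl | rfl | rfl
    · exact hyr h.symm
    · exact he.ne h.symm
    · exact hv.2.1 h
  · obtain rfl : i = 0 := by omega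
    exact (hGr v hv.1).symm
  · refine hGr u fun h => hu ?_
    rw [h]; exact apply_mem_pathFinset t' (i := 0) (by omega)

/-- The edges of a graph that consists of a geodesic, pendant vertices at one of its vertices, and
one more edge from one of these. -/
theorem edges_of_hub {G : SimpleGraph V} (hG : G.Connected)
    (hcard : G.edgeSet.ncard = Fintype.card V) {c : ℕ → V} (hc : IsGeodesic m G c) {k j : ℕ}
    {w : V} (hk : k ≤ m + 1) (hj : j ≤ m + 1) (hkj : k ≠ j) (hw : w ∉ pathFinset c m)
    (hub : ∀ u ∉ pathFinset c m, G.Adj u (c k)) (hwj : G.Adj w (c j)) {u v : V}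
    (huv : G.Adj u v) : (∃ i ≤ m, s(u, v) = s(c (i + 1), c i)) ∨
      (∃ y ∉ pathFinset c m, s(u, v) = s(y, c k)) ∨ s(u, v) = s(w, c j) := by
  obtain ⟨h, hh, hh'⟩ := exists_index (hc.injOn hG)
  set p : V → V := fun v => if v ∈ pathFinset c m then c (h v - 1) else c k with hp
  have hpath (i : ℕ) (hi : i ≤ m) : p (c (i + 1)) = c i := by
    simp only [hp, apply_mem_pathFinset c (show i + 1 ≤ m + 1 by omega), if_true,
      hh (i + 1) (by omega), Nat.add_sub_cancel]
  have hpoff (v : V) (hv : v ∉ pathFinset c m) : p v = c k := if_neg hv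
  have hcases (v : V) (hv : v ≠ c 0) : (∃ i ≤ m, v = c (i + 1)) ∨ v ∉ pathFinset c m := by
    by_cases hvm : v ∈ pathFinset c m
    · obtain ⟨i, hi, rfl⟩ := mem_pathFinset.1 hvm
      rcases i with _ | i
      · exact absurd rfl hv
      · exact Or.inl ⟨i, by omega, rfl⟩
    · exact Or.inr hvm
  obtain ⟨h1, -⟩ := edges_of_enumeration hcard (r := c 0) (g := fun v => s(v, p v))
    (e := s(w, c j))
    (injOn_sym2_of_rank (h := h) fun v hv => by
      rcases hcases v hv with ⟨i, hi, rfl⟩ | hvm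
      · rw [hpath i hi, hh i (by omega), hh (i + 1) (by omega)]; omega
      · rw [hpoff v hvm, hh k hk, hh' v hvm]; omega)
    (fun v hv => by
      rcases hcases v hv with ⟨i, hi, rfl⟩ | hvm
      · rw [hpath i hi]; exact (hc.adj i hi).symm
      · rw [hpoff v hvm]; exact hub v hvm)
    hwj (fun v hv he => by
      rcases hcases v hv with ⟨i, hi, rfl⟩ | hvm
      · have := Sym2.mem_mk_left w (c j)
        rw [← he, hpath i hi, Sym2.mem_iff] at this
        rcases this with rfl | rfl
        · exact hw (apply_mem_pathFinset c (by omega))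
        · exact hw (apply_mem_pathFinset c (by omega))
      · rw [hpoff v hvm] at he
        rcases Sym2.eq_iff.1 he with ⟨-, he⟩ | ⟨he, -⟩
        · exact hkj (hc.injOn hG (Set.mem_Iic.2 hk) (Set.mem_Iic.2 hj) he)
        · exact hvm (he ▸ apply_mem_pathFinset c hj))
  rcases h1 s(u, v) huv with he | ⟨v', hv', he⟩
  · exact Or.inr (Or.inr he)
  · rcases hcases v' hv' with ⟨i, hi, rfl⟩ | hvm
    · exact Or.inl ⟨i, hi, by rw [← he, hpath i hi]⟩
    · exact Or.inr (Or.inl ⟨v', hvm, by rw [← he, hpoff v' hvm]⟩)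

open Classical in
/-- The eigenvalue equations of `G` and of the spiral at the vertex `c k = t 0` of maximal value.
In the spiral this vertex is adjacent to all vertices off the path and to two vertices of the path
with the largest values; hence the same holds in `G`. -/
theorem hub_of_eigenvector (hm : 1 ≤ m) (h0 : 0 ≤ α) (h1 : α < 1) (hx : ∀ v, 0 < x v)
    {G H : SimpleGraph V} (hG : G.Connected) {c : ℕ → V} (hc : IsGeodesic m G c) {t : ℕ → V}
    {w : V} (hS : IsSpiral m H t w) (htP : pathFinset t m = pathFinset c m)
    (hanti : ∀ i j, i ≤ j → j ≤ m + 1 → x (t j) ≤ x (t i))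
    (hGx : Matrix.mulVec (alphaMatrix α G) x = ρ • x)
    (hHx : Matrix.mulVec (alphaMatrix α H) x = ρ • x) {k : ℕ} (hk : k ≤ m + 1)
    (hkt : c k = t 0) : 0 < k ∧ k ≤ m ∧ x (c (k - 1)) + x (c (k + 1)) = x (t 1) + x (t 2) ∧
      ∀ u ∉ pathFinset c m, G.Adj u (c k) := by
  set h : V → ℝ := fun u => α * x (c k) + (1 - α) * x u with hh
  have h1' : 0 < 1 - α := sub_pos.2 h1
  have hpos (u : V) : 0 < h u := by
    have a1 := mul_nonneg h0 (hx (c k)).le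
    have a2 := mul_pos h1' (hx u)
    simp only [hh]; linarith
  have hHsum : ρ * x (c k) = h (t 1) + (h (t 2) + ∑ u ∈ (pathFinset c m)ᶜ, h u) := by
    rw [hkt, eigenvector_apply_of_adj_iff hHx (hS.adj_zero_iff hm), Finset.sum_insert,
      Finset.sum_insert, htP]
    · simp only [hh, hkt]
    · simp [apply_mem_pathFinset t (show 2 ≤ m + 1 by omega)]
    · simp [apply_mem_pathFinset t (show 1 ≤ m + 1 by omega),
        hS.apply_ne (i := 1) (j := 2) (by omega) (by omega) (by omega)]
  set A := univ.filter fun u => G.Adj (c k) u with hA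
  have hGsum : ρ * x (c k) = ∑ u ∈ A.filter (· ∈ pathFinset c m), h u +
      ∑ u ∈ A.filter (· ∉ pathFinset c m), h u := by
    rw [Finset.sum_filter_add_sum_filter_not, eigenvector_apply hGx]
  have hoff : A.filter (· ∉ pathFinset c m) ⊆ (pathFinset c m)ᶜ := fun u hu =>
    mem_compl.2 (mem_filter.1 hu).2
  have hoffle := Finset.sum_le_sum_of_subset_of_nonneg hoff fun u _ _ => (hpos u).le
  have hmem (i : ℕ) (hi : i ≤ m + 1) (hik : i ≠ k) : ∃ j, 1 ≤ j ∧ j ≤ m + 1 ∧ c i = t j := by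
    have := apply_mem_pathFinset c hi
    rw [← htP] at this
    obtain ⟨j, hj, hji⟩ := mem_pathFinset.1 this
    refine ⟨j, Nat.one_le_iff_ne_zero.2 ?_, hj, hji.symm⟩
    rintro rfl
    exact hik (hc.injOn hG (Set.mem_Iic.2 hi) (Set.mem_Iic.2 hk) (hji.symm.trans hkt.symm))
  have hhle {u v : V} (huv : x u ≤ x v) : h u ≤ h v := by
    have := mul_le_mul_of_nonneg_left huv h1'.le
    simp only [hh]; linarith
  have hh1 (i : ℕ) (hi : i ≤ m + 1) (hik : i ≠ k) : h (c i) ≤ h (t 1) := by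
    obtain ⟨j, hj1, hj, hcj⟩ := hmem i hi hik
    rw [hcj]; exact hhle (hanti 1 j hj1 hj)
  have hmemA (u : V) : u ∈ A.filter (· ∈ pathFinset c m) ↔
      ∃ i ≤ m + 1, u = c i ∧ (i = k + 1 ∨ k = i + 1) := by
    rw [mem_filter, hA, mem_filter]
    constructor
    · rintro ⟨⟨-, h1⟩, h2⟩
      obtain ⟨i, hi, rfl⟩ := mem_pathFinset.1 h2
      exact ⟨i, hi, rfl, (hc.adj_iff hG hk hi).1 h1⟩
    · rintro ⟨i, hi, rfl, h⟩
      exact ⟨⟨mem_univ _, (hc.adj_iff hG hk hi).2 h⟩, apply_mem_pathFinset c hi⟩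
  have hsingle (i : ℕ) (hi : i ≤ m + 1) (hik : i ≠ k)
      (hAi : A.filter (· ∈ pathFinset c m) = {c i}) : False := by
    rw [hAi, Finset.sum_singleton] at hGsum
    have := hh1 i hi hik
    have := hpos (t 2)
    linarith
  have hk0 : 0 < k := by
    refine Nat.pos_of_ne_zero fun hk0 => hsingle 1 (by omega) (by omega) ?_
    ext u
    rw [hmemA, mem_singleton]
    constructor
    · rintro ⟨i, hi, rfl, h⟩
      rw [show i = 1 by omega]
    · rintro rfl
      exact ⟨1, by omega, rfl, by omega⟩
  have hkm : k ≤ m := by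
    by_contra hkm
    refine hsingle m (by omega) (by omega) ?_
    ext u
    rw [hmemA, mem_singleton]
    constructor
    · rintro ⟨i, hi, rfl, h⟩
      rw [show i = m by omega]
    · rintro rfl
      exact ⟨m, by omega, rfl, by omega⟩
  have hAeq : A.filter (· ∈ pathFinset c m) = {c (k - 1), c (k + 1)} := by
    ext u
    rw [hmemA, mem_insert, mem_singleton]
    constructor
    · rintro ⟨i, hi, rfl, h | h⟩
      · exact Or.inr (by rw [h])
      · exact Or.inl (by rw [show i = k - 1 by omega])
    · rintro (rfl | rfl)
      · exact ⟨k - 1, by omega, rfl, by omega⟩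
      · exact ⟨k + 1, by omega, rfl, by omega⟩
  have hne : c (k - 1) ≠ c (k + 1) := fun h => absurd
    (hc.injOn hG (Set.mem_Iic.2 (by omega)) (Set.mem_Iic.2 (by omega)) h) (by omega)
  rw [hAeq, Finset.sum_pair hne] at hGsum
  have hpair : h (c (k - 1)) + h (c (k + 1)) ≤ h (t 1) + h (t 2) := by
    obtain ⟨i, hi1, hi, hci⟩ := hmem (k - 1) (by omega) (by omega)
    obtain ⟨j, hj1, hj, hcj⟩ := hmem (k + 1) (by omega) (by omega)
    rw [hci, hcj] at hne ⊢
    rcases lt_trichotomy i j with hij | hij | hij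
    · exact add_le_add (hhle (hanti 1 i hi1 hi)) (hhle (hanti 2 j (by omega) hj))
    · exact absurd (by rw [hij]) hne
    · rw [add_comm]
      exact add_le_add (hhle (hanti 1 j hj1 hj)) (hhle (hanti 2 i (by omega) hi))
  refine ⟨hk0, hkm, ?_, fun u hu => ?_⟩
  · have : h (c (k - 1)) + h (c (k + 1)) = h (t 1) + h (t 2) := by linarith
    simp only [hh] at this
    have h2 : (1 - α) * (x (c (k - 1)) + x (c (k + 1))) = (1 - α) * (x (t 1) + x (t 2)) := by
      linarith
    exact mul_left_cancel₀ h1'.ne' h2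
  · have := mem_of_sum_le_of_subset hoff hpos (by linarith) (mem_compl.2 hu)
    rw [mem_filter, hA, mem_filter] at this
    exact this.1.2.symm

/-- A path with pendant vertices at its middle vertex, one of which is also joined to the next
vertex of the path, is a spiral. -/
theorem isSpiral_of_middle {G : SimpleGraph V} (hG : G.Connected)
    (hcard : G.edgeSet.ncard = Fintype.card V) {c : ℕ → V} (hc : IsGeodesic m G c) {k : ℕ}
    (hk : k = (m + 1) / 2) {w : V} (hw : w ∉ pathFinset c m)
    (hub : ∀ u ∉ pathFinset c m, G.Adj u (c k)) (hwk : G.Adj w (c (k + 1))) :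
    IsSpiral m G (fun i => if i % 2 = 0 then c (k - i / 2) else c (k + 1 + i / 2)) w := by
  set t : ℕ → V := fun i => if i % 2 = 0 then c (k - i / 2) else c (k + 1 + i / 2) with ht
  have hte {i : ℕ} (hi : i % 2 = 0) : t i = c (k - i / 2) := if_pos hi
  have hto {i : ℕ} (hi : i % 2 ≠ 0) : t i = c (k + 1 + i / 2) := if_neg hi
  have hinj {i j : ℕ} (hi : i ≤ m + 1) (hj : j ≤ m + 1) (h : c i = c j) : i = j :=
    hc.injOn hG (Set.mem_Iic.2 hi) (Set.mem_Iic.2 hj) h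
  have hP : pathFinset t m = pathFinset c m := by
    ext u
    rw [mem_pathFinset, mem_pathFinset]
    constructor
    · rintro ⟨i, hi, rfl⟩
      by_cases h : i % 2 = 0
      · exact ⟨k - i / 2, by omega, (hte h).symm⟩
      · exact ⟨k + 1 + i / 2, by omega, (hto h).symm⟩
    · rintro ⟨l, hl, rfl⟩
      by_cases h : l ≤ k
      · refine ⟨2 * (k - l), by omega, ?_⟩
        rw [hte (by omega)]; congr 1; omega
      · refine ⟨2 * (l - k - 1) + 1, by omega, ?_⟩
        rw [hto (by omega)]; congr 1; omega
  have e0 : t 0 = c k := rfl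
  have e1 : t 1 = c (k + 1) := rfl
  refine ⟨fun i hi j hj hij => ?_, hP ▸ hw, ?_, fun i hi => ?_, hwk, fun u hu => ?_, hcard⟩
  · rw [Set.mem_Iic] at hi hj
    by_cases h : i % 2 = 0 <;> by_cases h' : j % 2 = 0
    · rw [hte h, hte h'] at hij
      have := hinj (by omega) (by omega) hij
      omega
    · rw [hte h, hto h'] at hij
      have := hinj (by omega) (by omega) hij
      omega
    · rw [hto h, hte h'] at hij
      have := hinj (by omega) (by omega) hij
      omega
    · rw [hto h, hto h'] at hij
      have := hinj (by omega) (by omega) hij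
      omega
  · exact hc.adj k (by omega)
  · by_cases h : i % 2 = 0
    · rw [hte h, hte (show (i + 2) % 2 = 0 by omega)]
      exact (hc.adj_iff hG (by omega) (by omega)).2 (by omega)
    · rw [hto h, hto (show (i + 2) % 2 ≠ 0 by omega)]
      exact (hc.adj_iff hG (by omega) (by omega)).2 (by omega)
  · exact hub u (hP ▸ hu)

open Classical in
/-- If the extra edge of `G` joins a pendant vertex at `c k` to a later vertex `c j` of the path,
then `j = k + 1`, and `c k` is the middle of the path: along the arm `c k, c (k - 1), …` of the
path the eigenvalue equations determine the values one after the other, and these are the values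
along the arm `t 0, t 2, …` of the spiral, so that both arms have the same length. -/
theorem exists_isSpiral_of_hub (hm : 2 ≤ m) (h0 : 0 ≤ α) (h1 : α < 1) (hx : ∀ v, 0 < x v)
    {G H : SimpleGraph V} (hG : G.Connected) (hcard : G.edgeSet.ncard = Fintype.card V)
    {c : ℕ → V} (hc : IsGeodesic m G c) {t : ℕ → V} {w : V} (hS : IsSpiral m H t w)
    (htP : pathFinset t m = pathFinset c m)
    (hanti : ∀ i j, i ≤ j → j ≤ m + 1 → x (t j) ≤ x (t i))
    (hGx : Matrix.mulVec (alphaMatrix α G) x = ρ • x)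
    (hHx : Matrix.mulVec (alphaMatrix α H) x = ρ • x) {k : ℕ} (hk0 : 0 < k) (hkm : k ≤ m)
    (hkt : c k = t 0) (hsum : x (c (k - 1)) + x (c (k + 1)) = x (t 1) + x (t 2))
    (hub : ∀ u ∉ pathFinset c m, G.Adj u (c k)) (hwt : x w < x (t 1)) {j : ℕ} (hj : j ≤ m + 1)
    (hkj : k < j) (hwj : G.Adj w (c j)) (hxj : x (c j) = x (t 1)) :
    ∃ t' w', IsSpiral m G t' w' := by
  have h1' : 0 < 1 - α := sub_pos.2 h1
  have hwP : w ∉ pathFinset c m := htP ▸ hS.notMem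
  have hcw (i : ℕ) (hi : i ≤ m + 1) : c i ≠ w := fun h => hwP (h ▸ apply_mem_pathFinset c hi)
  have hinj {i j : ℕ} (hi : i ≤ m + 1) (hj : j ≤ m + 1) (h : c i = c j) : i = j :=
    hc.injOn hG (Set.mem_Iic.2 hi) (Set.mem_Iic.2 hj) h
  have hedge {u v : V} (huv : G.Adj u v) :=
    edges_of_hub hG hcard hc (show k ≤ m + 1 by omega) hj hkj.ne hwP hub hwj huv
  -- a vertex of the path other than `c k` and `c j` has no neighbours off the path
  have hnbr (l : ℕ) (hl : l ≤ m + 1) (hlk : l ≠ k) (hlj : l ≠ j) (u : V)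
      (hu : G.Adj (c l) u) : ∃ i ≤ m + 1, u = c i ∧ (i = l + 1 ∨ l = i + 1) := by
    rcases hedge hu with ⟨i, hi, h⟩ | ⟨y, hy, h⟩ | h
    · rcases Sym2.eq_iff.1 h with ⟨h2, rfl⟩ | ⟨h2, rfl⟩
      · exact ⟨i, by omega, rfl, Or.inr (hinj hl (by omega) h2)⟩
      · exact ⟨i + 1, by omega, rfl, Or.inl (by rw [hinj hl (by omega) h2])⟩
    · rcases Sym2.eq_iff.1 h with ⟨h2, -⟩ | ⟨h2, -⟩
      · exact absurd (h2 ▸ apply_mem_pathFinset c hl) hy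
      · exact absurd (hinj hl (by omega) h2) hlk
    · rcases Sym2.eq_iff.1 h with ⟨h2, -⟩ | ⟨h2, -⟩
      · exact absurd h2 (hcw l hl)
      · exact absurd (hinj hl hj h2) hlj
  have hdist : j ≤ k + 2 := by
    have a1 := hc.dist_eq hG hkj.le hj
    have a2 := hG.dist_triangle (u := c k) (v := w) (w := c j)
    have a3 := SimpleGraph.dist_eq_one_iff_adj.2 (hub w hwP).symm
    have a4 := SimpleGraph.dist_eq_one_iff_adj.2 hwj
    omega
  have hjk : j = k + 1 := by
    by_contra hne
    obtain rfl : j = k + 2 := by omega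
    -- `w` and `c (k + 1)` have the same neighbours in `G`, hence the same value
    have hkk : c k ≠ c (k + 2) := fun h => absurd (hinj (by omega) hj h) (by omega)
    have hGw (u : V) : G.Adj w u ↔ u ∈ ({c k, c (k + 2)} : Finset V) := by
      rw [mem_insert, mem_singleton]
      constructor
      · intro h
        rcases hedge h with ⟨i, hi, h⟩ | ⟨y, hy, h⟩ | h
        · rcases Sym2.eq_iff.1 h with ⟨h2, -⟩ | ⟨h2, -⟩
          · exact absurd h2.symm (hcw _ (by omega))
          · exact absurd h2.symm (hcw _ (by omega))
        · rcases Sym2.eq_iff.1 h with ⟨-, h2⟩ | ⟨h2, -⟩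
          · exact Or.inl h2
          · exact absurd h2.symm (hcw _ (by omega))
        · rcases Sym2.eq_iff.1 h with ⟨-, h2⟩ | ⟨h2, -⟩
          · exact Or.inr h2
          · exact absurd h2.symm (hcw _ (by omega))
      · rintro (rfl | rfl)
        · exact hub w hwP
        · exact hwj
    have hGk (u : V) : G.Adj (c (k + 1)) u ↔ u ∈ ({c k, c (k + 2)} : Finset V) := by
      rw [mem_insert, mem_singleton]
      constructor
      · intro h
        obtain ⟨i, hi, rfl, h | h⟩ := hnbr (k + 1) (by omega) (by omega) (by omega) u h
        · exact Or.inr (by rw [h])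
        · exact Or.inl (by rw [show i = k by omega])
      · rintro (rfl | rfl)
        · exact (hc.adj_iff hG (by omega) (by omega)).2 (by omega)
        · exact (hc.adj_iff hG (by omega) (by omega)).2 (by omega)
    have b1 := eigenvector_apply_of_adj_iff hGx hGw
    have b2 := eigenvector_apply_of_adj_iff hGx hGk
    rw [Finset.sum_pair hkk] at b1 b2
    have b3 : 0 < (ρ - 2 * α) * x w := by
      have a1 := mul_pos h1' (hx (c k))
      have a2 := mul_pos h1' (hx (c (k + 2)))
      linarith
    have b4 : 0 < ρ - 2 * α := pos_of_mul_pos_left b3 (hx w).le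
    have b5 : x w = x (c (k + 1)) := by
      have : (ρ - 2 * α) * x w = (ρ - 2 * α) * x (c (k + 1)) := by linarith
      exact mul_left_cancel₀ b4.ne' this
    -- `c (k + 2)` has the value `x (t 1)`, so both neighbours of `c k` on the path have values at
    -- most `x (t 2)`; their sum then forces `x (c (k + 1)) = x (t 1)`
    have hpair (i : ℕ) (hi : i ≤ m + 1) (hik : i ≠ k) (hi2 : i ≠ k + 2) : x (c i) ≤ x (t 2) := by
      have mem (l : ℕ) (hl : l ≤ m + 1) (hlk : l ≠ k) : ∃ q, 1 ≤ q ∧ q ≤ m + 1 ∧ c l = t q := by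
        have := apply_mem_pathFinset c hl
        rw [← htP] at this
        obtain ⟨q, hq, hql⟩ := mem_pathFinset.1 this
        refine ⟨q, Nat.one_le_iff_ne_zero.2 ?_, hq, hql.symm⟩
        rintro rfl
        exact hlk (hinj hl (by omega) (hql.symm.trans hkt.symm))
      obtain ⟨q, hq1, hq, hiq⟩ := mem i hi hik
      obtain ⟨q', hq1', hq', hiq'⟩ := mem (k + 2) hj (by omega)
      have hqq : q ≠ q' := by
        rintro rfl
        exact hi2 (hinj hi hj (hiq.trans hiq'.symm))
      rcases Nat.lt_or_ge 1 q with h | h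
      · rw [hiq]; exact hanti 2 q h hq
      · obtain rfl : q = 1 := by omega
        have := hanti 2 q' (by omega) hq'
        rw [← hiq', hxj] at this
        rwa [hiq]
    have c1 := hpair (k - 1) (by omega) (by omega) (by omega)
    have c2 := hpair (k + 1) (by omega) (by omega) (by omega)
    have c3 := hanti 1 2 (by omega) (by omega)
    linarith
  subst hjk
  have hstart : x (c (k - 1)) = x (t 2) := by linarith
  have claim (i : ℕ) : (i + 1 ≤ k ↔ 2 * i + 2 ≤ m + 1) ∧ (i + 1 ≤ k →
      x (c (k - i)) = x (t (2 * i)) ∧ x (c (k - (i + 1))) = x (t (2 * i + 2))) := by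
    induction i with
    | zero => exact ⟨⟨fun _ => by omega, fun _ => hk0⟩, fun _ => ⟨by rw [Nat.sub_zero, hkt],
        hstart⟩⟩
    | succ i ih =>
      obtain ⟨ih1, ih2⟩ := ih
      by_cases hik : i + 1 ≤ k
      · obtain ⟨v1, v2⟩ := ih2 hik
        have him := ih1.1 hik
        have hadj := hS.adj_add_two_iff (i := 2 * i) (by omega)
        -- the equation of the spiral at `t (2 * i + 2)`
        have eH : ρ * x (t (2 * i + 2)) = (α * x (t (2 * i + 2)) + (1 - α) * x (t (2 * i))) +
            if 2 * i + 2 < m then α * x (t (2 * i + 2)) + (1 - α) * x (t (2 * i + 4)) else 0 := by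
          split_ifs with hlt
          · rw [eigenvector_apply_of_adj_iff hHx (S := {t (2 * i), t (2 * i + 4)})
              (fun u => by simp [hadj, hlt]),
              Finset.sum_pair (hS.apply_ne (by omega) (by omega) (by omega))]
          · rw [eigenvector_apply_of_adj_iff hHx (S := {t (2 * i)})
              (fun u => by simp [hadj, hlt]), Finset.sum_singleton, add_zero]
        -- the equation of `G` at `c (k - (i + 1))`
        have hadjG (u : V) : G.Adj (c (k - (i + 1))) u ↔
            u = c (k - i) ∨ (i + 2 ≤ k ∧ u = c (k - (i + 2))) := by
          constructor
          · intro h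
            obtain ⟨l, hl, rfl, h | h⟩ := hnbr (k - (i + 1)) (by omega) (by omega) (by omega) u h
            · exact Or.inl (by rw [show l = k - i by omega])
            · exact Or.inr ⟨by omega, by rw [show l = k - (i + 2) by omega]⟩
          · rintro (rfl | ⟨h, rfl⟩)
            · exact (hc.adj_iff hG (by omega) (by omega)).2 (by omega)
            · exact (hc.adj_iff hG (by omega) (by omega)).2 (by omega)
        have eG : ρ * x (c (k - (i + 1))) =
            (α * x (c (k - (i + 1))) + (1 - α) * x (c (k - i))) +
            if i + 2 ≤ k then α * x (c (k - (i + 1))) + (1 - α) * x (c (k - (i + 2))) else 0 := by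
          split_ifs with hlt
          · rw [eigenvector_apply_of_adj_iff hGx (S := {c (k - i), c (k - (i + 2))})
              (fun u => by simp [hadjG, hlt]), Finset.sum_pair]
            exact fun h => absurd (hinj (by omega) (by omega) h) (by omega)
          · rw [eigenvector_apply_of_adj_iff hGx (S := {c (k - i)})
              (fun u => by simp [hadjG, hlt]), Finset.sum_singleton, add_zero]
        rw [v1, v2] at eG
        have hpos (u : V) : 0 < α * x (t (2 * i + 2)) + (1 - α) * x u :=
          add_pos_of_nonneg_of_pos (mul_nonneg h0 (hx _).le) (mul_pos h1' (hx u))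
        have heq : (if i + 2 ≤ k then α * x (t (2 * i + 2)) + (1 - α) * x (c (k - (i + 2))) else 0)
            = if 2 * i + 2 < m then α * x (t (2 * i + 2)) + (1 - α) * x (t (2 * i + 4)) else 0 := by
          linarith
        -- either both arms continue or both end here
        by_cases hA : i + 2 ≤ k <;> by_cases hB : 2 * i + 2 < m
        · rw [if_pos hA, if_pos hB] at heq
          refine ⟨⟨fun _ => by omega, fun _ => hA⟩, fun _ => ⟨v2, ?_⟩⟩
          exact mul_left_cancel₀ h1'.ne' (add_left_cancel heq)
        · rw [if_pos hA, if_neg hB] at heq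
          exact absurd heq (hpos _).ne'
        · rw [if_neg hA, if_pos hB] at heq
          exact absurd heq.symm (hpos _).ne'
        · exact ⟨⟨fun h => absurd h hA, fun h => by omega⟩, fun h => absurd h hA⟩
      · exact ⟨⟨fun h => by omega, fun h => by omega⟩, fun h => by omega⟩
  have hmid : k = (m + 1) / 2 := by
    have a1 := (claim (k - 1)).1
    have a2 := (claim k).1
    omega
  exact ⟨_, w, isSpiral_of_middle hG hcard hc hmid hwP hub hwj⟩

open Classical in
/-- If `G` and a spiral on the path of `G`, sorted by decreasing value, have a common Perron
vector, then `G` is a spiral. -/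
theorem exists_isSpiral_of_eigenvector (hm : 2 ≤ m) (h0 : 0 ≤ α) (h1 : α < 1)
    (hx : ∀ v, 0 < x v) {G H : SimpleGraph V} (hG : G.Connected)
    (hcard : G.edgeSet.ncard = Fintype.card V) {c : ℕ → V} (hc : IsGeodesic m G c) {t : ℕ → V}
    {w : V} (hS : IsSpiral m H t w) (htP : pathFinset t m = pathFinset c m)
    (hanti : ∀ i j, i ≤ j → j ≤ m + 1 → x (t j) ≤ x (t i))
    (hGx : Matrix.mulVec (alphaMatrix α G) x = ρ • x)
    (hHx : Matrix.mulVec (alphaMatrix α H) x = ρ • x) {j : ℕ} (hj : j ≤ m + 1) (hj0 : c j ≠ t 0)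
    (hwj : G.Adj w (c j)) (hxj : x (c j) = x (t 1)) : ∃ t' w', IsSpiral m G t' w' := by
  have hwt := hS.apply_w_lt hm h0 h1 hx hHx
  obtain ⟨k, hk, hkt⟩ := mem_pathFinset.1 (htP ▸ apply_mem_pathFinset t (show 0 ≤ m + 1 by omega))
  obtain ⟨hk0, hkm, hsum, hub⟩ :=
    hub_of_eigenvector (by omega) h0 h1 hx hG hc hS htP hanti hGx hHx hk hkt
  rcases lt_trichotomy k j with hkj | rfl | hkj
  · exact exists_isSpiral_of_hub hm h0 h1 hx hG hcard hc hS htP hanti hGx hHx hk0 hkm hkt hsum hub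
      hwt hj hkj hwj hxj
  · exact absurd hkt hj0
  · -- reverse the path
    have hrk : m + 1 - (m + 1 - k) = k := by omega
    have hrj : m + 1 - (m + 1 - j) = j := by omega
    refine exists_isSpiral_of_hub hm h0 h1 hx hG hcard hc.reverse hS
      (by rw [pathFinset_reverse, htP]) hanti hGx hHx (k := m + 1 - k) (by omega) (by omega) ?_ ?_
      ?_ hwt (j := m + 1 - j) (by omega) (by omega) ?_ ?_
    · simp only [hrk]; exact hkt
    · rw [← hsum, show m + 1 - (m + 1 - k - 1) = k + 1 by omega,
        show m + 1 - (m + 1 - k + 1) = k - 1 by omega, add_comm]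
    · rw [pathFinset_reverse]; simp only [hrk]; exact hub
    · simp only [hrj]; exact hwj
    · simp only [hrj]; exact hxj

end Equality

/-! ### The extremal problem -/

section Extremal

open Finset

/-- Every connected graph with as many edges as vertices and diameter `m + 1` has at most the
`α`-spectral radius of the spiral of the same order and diameter, and equality characterizes the
spiral. -/
theorem alphaSpectralRadius_le_of_isSpiral {V W : Type*} [Fintype V] [DecidableEq V] [Fintype W]
    [DecidableEq W] {α : ℝ} {m : ℕ} (hm : 1 ≤ m) (h0 : 0 ≤ α) (h1 : α < 1) {G : SimpleGraph V}
    (hG : G.Connected) (hcard : G.edgeSet.ncard = Fintype.card V) (hd : G.diam = m + 1)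
    {U : SimpleGraph W} (hU : U.Connected) {tU : ℕ → W} {wU : W} (hSU : IsSpiral m U tU wU)
    (hVW : Fintype.card V = Fintype.card W) (h4 : 4 ≤ Fintype.card V) :
    alphaSpectralRadius α G ≤ alphaSpectralRadius α U ∧
      (alphaSpectralRadius α G = alphaSpectralRadius α U ↔ Nonempty (G ≃g U)) := by
  classical
  obtain ⟨c, hc⟩ := exists_isGeodesic hG hd
  obtain ⟨ρ, x, hρG, hρ0, hx, hGx, -, -⟩ := exists_perron h0 h1 hG
  obtain ⟨t, w, htinj, hw, hle⟩ := exists_le_spiralWeight hm h0 h1 hx hG hcard hc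
  -- the spiral on the vertex set of `G` with the rearranged parameters
  obtain ⟨H, hS, ⟨φ⟩⟩ := hSU.exists_copy hVW htinj hw
  obtain ⟨ρ', -, hρH, hρ'0, -, -, hray, hrayeq⟩ := exists_perron h0 h1 (φ.connected_iff.2 hU)
  have := hG.nonempty
  have hxx : 0 < x ⬝ᵥ x := Finset.sum_pos (fun v _ => mul_pos (hx v) (hx v)) univ_nonempty
  have hquadG : ρ * (x ⬝ᵥ x) = ∑ e ∈ G.edgeFinset, pairWeight α x e := by
    rw [← dotProduct_alphaMatrix_mulVec, hGx, dotProduct_smul, smul_eq_mul]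
  have hquadH : x ⬝ᵥ Matrix.mulVec (alphaMatrix α H) x = spiralWeight α x m t w := by
    rw [dotProduct_alphaMatrix_mulVec, hS.sum_pairWeight]
  have hrayx := hray x
  rw [hquadH] at hrayx
  have hweak : ∑ e ∈ G.edgeFinset, pairWeight α x e ≤ spiralWeight α x m t w := by
    rcases hle with h | h
    · exact h.le
    · exact h.1
  have hρρ : ρ ≤ ρ' := le_of_mul_le_mul_right (by linarith) hxx
  rw [← alphaSpectralRadius_congr α φ]
  refine ⟨by rw [hρG, hρH]; exact ENNReal.ofReal_le_ofReal hρρ, fun heq => ?_, fun ⟨ψ⟩ => ?_⟩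
  · rw [hρG, hρH, ENNReal.ofReal_eq_ofReal_iff hρ0 hρ'0] at heq
    subst heq
    have hEq : ∑ e ∈ G.edgeFinset, pairWeight α x e = spiralWeight α x m t w := by linarith
    have hHx : Matrix.mulVec (alphaMatrix α H) x = ρ • x :=
      hrayeq x (by rw [hquadH]; linarith)
    have hspiral : ∃ t' w', IsSpiral m G t' w' := by
      rcases hm.eq_or_lt with rfl | hm2
      · exact exists_isSpiral_of_star h0 h1 hx hcard h4 hS hGx hHx
      · rcases hle with h | ⟨-, h | ⟨htP, hanti, j, hj, hj0, hwj, hxj⟩⟩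
        · exact absurd hEq h.ne
        · exact absurd h (not_le.2 (hS.apply_w_lt hm2 h0 h1 hx hHx))
        · exact exists_isSpiral_of_eigenvector hm2 h0 h1 hx hG hcard hc hS htP hanti hGx hHx hj hj0
            hwj (hxj hEq)
    obtain ⟨t', w', hS'⟩ := hspiral
    exact hS'.iso hVW hSU
  · exact alphaSpectralRadius_congr α (ψ.trans φ.symm)

end Extremal

theorem mainTheorem1 (n d : ℕ) (hd : 2 ≤ d) (hdn : d + 2 ≤ n) (α : ℝ) (hα0 : 0 ≤ α) (hα1 : α < 1) :
    ∃ s a b : ℕ, b ≤ a ∧ a ≤ b + 1 ∧ d = a + b + 1 ∧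
      IsUnicyclicOfDiam n d (delta2 s a b) ∧
      ∀ (V : Type*) [Fintype V] [DecidableEq V] (G : SimpleGraph V), IsUnicyclicOfDiam n d G →
        alphaSpectralRadius α G ≤ alphaSpectralRadius α (delta2 s a b) ∧
        (alphaSpectralRadius α G = alphaSpectralRadius α (delta2 s a b) ↔
          Nonempty (G ≃g delta2 s a b)) := by
  obtain ⟨a, b, hba, hab, rfl⟩ : ∃ a b, b ≤ a ∧ a ≤ b + 1 ∧ d = a + b + 1 :=
    ⟨d / 2, (d - 1) / 2, by omega, by omega, by omega⟩
  obtain ⟨s, rfl⟩ : ∃ s, n = s + a + b + 3 := ⟨n - (a + b + 3), by omega⟩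
  have hcard : Fintype.card (Delta2Vertex s a b) = s + a + b + 3 := by
    simp only [Delta2Vertex, Fintype.card_sum, Fintype.card_fin]; omega
  refine ⟨s, a, b, hba, hab, rfl,
    ⟨delta2_connected, hcard, delta2_card_edges.trans hcard, delta2_diam hba hab (by omega)⟩,
    fun V _ _ G ⟨hG, hV, hE, hdiam⟩ => ?_⟩
  exact alphaSpectralRadius_le_of_isSpiral (m := a + b) (by omega) hα0 hα1 hG (hE.trans hV.symm)
    hdiam delta2_connected (delta2_isSpiral hba hab) (hV.trans hcard.symm) (by omega)
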